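/- **Subject reduction.** Variables $x,y,z$ range over a countably infinite set, values are $v ::= x \mid \mathtt{true} \mid \mathtt{false}$, $\xi$ ranges over access labels, and $\Phi$ over trace sets (prefix-closed sets of finite sequences of access labels); $\Phi^{-\xi}=\{s \mid \xi s\in\Phi\}$. Terms are identified up to renaming of bound variables. *Processes.* $P ::= \mathbf 0 \mid \bar x\langle\tilde v\rangle.P \mid x(\tilde y).P \mid P|Q \mid \mathbf{if}\ v\ \mathbf{then}\ P\ \mathbf{else}\ Q \mid (\nu x)P \mid {*}P \mid \mathbf{acc}_\xi(x).P \mid (\mathfrak N^{\Phi}x)P$, where $x(\tilde y)$, $(\nu x)$ and $(\mathfrak N^\Phi x)$ bind. The structural preorder $\preceq$ is the least reflexive transitive relation such that $|$ is commutative and associative with unit $\mathbf 0$ (in both directions), ${*}P\preceq {*}P|P$, $(\nu x)P|Q\preceq(\nu x)(P|Q)$ and $(\mathfrak N^\Phi x)P|Q\preceq(\mathfrak N^\Phi x)(P|Q)$ if $x\notin \mathbf{FV}(Q)$, closed under $|$, $(\nu x)$ and $(\mathfrak N^\Phi x)$. Reduction $P\xrightarrow{L}P'$ with $L::=x^\xi\mid\tau$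 is the least relation with $\bar x\langle\tilde v\rangle.P\,|\,x(\tilde y).Q\xrightarrow{\tau}P|[\tilde v/\tilde y]Q$; $\ \mathbf{acc}_\xi(x).P\xrightarrow{x^\xi}P$; $\ \mathbf{if}\ \mathtt{true}\ \mathbf{then}\ P\ \mathbf{else}\ Q\xrightarrow{\tau}P$; $\ \mathbf{if}\ \mathtt{false}\ \mathbf{then}\ P\ \mathbf{else}\ Q\xrightarrow{\tau}Q$; if $P\xrightarrow{L}P'$ then $P|Q\xrightarrow{L}P'|Q$, and, if $L$ is not an access to $x$, $(\nu x)P\xrightarrow{L}(\nu x)P'$ and $(\mathfrak N^\Phi x)P\xrightarrow{L}(\mathfrak N^\Phi x)P'$; if $P\xrightarrow{x^\xi}P'$ then $(\mathfrak N^\Phi x)P\xrightarrow{\tau}(\mathfrak N^{\Phi^{-\xi}}x)P'$; and if $P\preceq Q\xrightarrow{L}Q'\preceq P'$ then $P\xrightarrow{L}P'$. *Behavioral types.* $A ::= \mathbf 0 \mid \alpha \mid a.A \mid x^\xi.A \mid A|B \mid A\oplus B \mid {*}A \mid \langle\tilde v/\tilde x\rangle A \mid (\nu x)A \mid \mu\alpha.A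 \mid A{\uparrow}_S \mid A{\downarrow}_S$ with $a::=x\mid\bar x\mid\tau$ and $S$ a finite set of variables; types have no free recursion variables. Here $\langle\tilde v/\tilde x\rangle$ is a delayed substitution, a constructor, and $\mathbf{FV}(\langle\tilde v/\tilde x\rangle A)=(\mathbf{FV}(A)\setminus\tilde x)\cup\mathbf{FV}(\tilde v)$, $\mathbf{FV}(A{\uparrow}_S)=\mathbf{FV}(A)\setminus S$, $\mathbf{FV}(A{\downarrow}_S)=\mathbf{FV}(A)\cap S$. Labels are $l::=x\mid\bar x\mid\tau\mid x^\xi\mid\{x,\bar y\}$, and $\mathrm{target}(l)$ is the set of variables of $l$. Transitions $A\xrightarrow{l}A'$ are the least relation with: $a.A\xrightarrow{a}A$; $x^\xi.A\xrightarrow{x^\xi}A$; $A|B$ does the transitions of each component, and $\{x,\bar y\}$ when one component does $x$ and the other $\bar y$; if $A\xrightarrow{\{x,\bar x\}}A'$ then $A\xrightarrow{\tau}A'$; $A\oplus B$ does the transitions of $A$ and of $B$; ${*}A$ does those of $A|{*}A$, and $\mu\alpha.A$ those of $[\mu\alpha.A/\alpha]A$; if $A\xrightarrow{l}A'$ then $\langle\tilde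 v/\tilde x\rangle A\xrightarrow{[\tilde v/\tilde x]l}\langle\tilde v/\tilde x\rangle A'$ (provided no variable of $l$ is replaced by a boolean) and, if $x\notin\mathrm{target}(l)$, $(\nu x)A\xrightarrow{l}(\nu x)A'$; if $A\xrightarrow{l}A'$ and $\mathrm{target}(l)\subseteq S$ then $A{\uparrow}_S\xrightarrow{\tau}A'{\uparrow}_S$ and $A{\downarrow}_S\xrightarrow{l}A'{\downarrow}_S$; if $A\xrightarrow{l}A'$ and $\mathrm{target}(l)\cap S=\emptyset$ then $A{\uparrow}_S\xrightarrow{l}A'{\uparrow}_S$ and $A{\downarrow}_S\xrightarrow{\tau}A'{\downarrow}_S$. The relation $\Rightarrow$ is the reflexive transitive closure of $\xrightarrow{\tau}$; $\overset{\tau}{\Rightarrow}$ is $\Rightarrow$, and $\overset{l}{\Rightarrow}$ is $\Rightarrow\xrightarrow{l}\Rightarrow$ for $l\ne\tau$. The relation $\geq$ is the largest one such that $A\geq B\xrightarrow{l}B'$ implies $A\overset{l}{\Rightarrow}A'\geq B'$ for some $A'$. Finally $\mathrm{traces}_x(A)=\{\xi_1\cdots\xi_n \mid A{\downarrow}_{\{x\}}\overset{x^{\xi_1}}{\Longrightarrow}\cdots\overset{x^{\xi_n}}{\Longrightarrow}\}$.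 *Typing.* Value types are $\sigma::=\mathbf{bool}\mid\mathbf{res}\mid\mathbf{chan}\langle(\tilde y:\tilde\sigma)A\rangle$, where $\mathbf{FV}(A)\subseteq\{\tilde y\}$ and $\tilde y$ is bound. Let $\Gamma$ range over finite maps from variables to value types. Booleans have type $\mathbf{bool}$, and variables the type that $\Gamma$ gives them. The judgement $\Gamma\triangleright P:A$ is defined by the following rules, in which variables added to $\Gamma$ are distinct and not in its domain: * $\Gamma\triangleright\mathbf 0:\mathbf 0$. * If $\Gamma\triangleright P:A_2$, $\Gamma\triangleright x:\mathbf{chan}\langle(\tilde y:\tilde\sigma)A_1\rangle$ and $\Gamma\triangleright\tilde v:\tilde\sigma$, then $\Gamma\triangleright\bar x\langle\tilde v\rangle.P:\bar x.(\langle\tilde v/\tilde y\rangle A_1\,|\,A_2)$. * If $\Gamma,\tilde y:\tilde\sigma\triangleright P:A_2$, $\Gamma\triangleright x:\mathbf{chan}\langle(\tilde y:\tilde\sigma)A_1\rangle$ and $A_1\geq A_2{\downarrow}_{\{\tilde y\}}$, then $\Gamma\triangleright x(\tilde y).P:x.(A_2{\uparrow}_{\{\tilde y\}})$. * If $\Gamma\triangleright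 P:A$ and $\Gamma\triangleright Q:B$, then $\Gamma\triangleright P|Q:A|B$. * If $\Gamma\triangleright v:\mathbf{bool}$, $\Gamma\triangleright P:A$ and $\Gamma\triangleright Q:A$, then $\Gamma\triangleright\mathbf{if}\ v\ \mathbf{then}\ P\ \mathbf{else}\ Q:A$. * If $\Gamma\triangleright P:A$, then $\Gamma\triangleright{*}P:{*}A$. * If $\Gamma,x:\mathbf{chan}\langle(\tilde y:\tilde\sigma)B\rangle\triangleright P:A$, then $\Gamma\triangleright(\nu x)P:(\nu x)A$. * If $\Gamma\triangleright P:A$ and $\Gamma\triangleright x:\mathbf{res}$, then $\Gamma\triangleright\mathbf{acc}_\xi(x).P:x^\xi.A$. * If $\Gamma,x:\mathbf{res}\triangleright P:A$ and $\mathrm{traces}_x(A)\subseteq\Phi$, then $\Gamma\triangleright(\mathfrak N^\Phi x)P:A{\uparrow}_{\{x\}}$. * If $\Gamma\triangleright P:A'$ and $A\geq A'$, then $\Gamma\triangleright P:A$. **Claim.** If $P\xrightarrow{L}P'$ and $\Gamma\triangleright P:A$, then there is a behavioral type $A'$ such that $A\overset{L}{\Rightarrow}A'$ and $\Gamma\triangleright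 P':A'$. -/

import Mathlib

/-! # A pi-calculus with resource primitives and its behavioural type system

Variables are natural numbers.  Terms are taken up to renaming of bound variables, which is
obtained by the de Bruijn representation: below a binder of `n` variables the numbers
`0, …, n-1` stand for the bound variables, and `z + n` stands for the outer variable `z`. -/

namespace ResPi

universe u

/-- Variables `x, y, z`. -/
abbrev Var := ℕ

/-- Values `v ::= x | true | false`. -/
inductive Val where
  | var (x : Var)
  | bool (b : Bool)

namespace Val

/-- Renaming of the variable of a value. -/
def rename (f : Var → Var) : Val → Val
  | var x => var (f x)
  | bool b => bool b

/-- The variable that a value is, if it is one. -/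
def var? : Val → Option Var
  | var x => some x
  | bool _ => none

/-- Application of a substitution to a value. -/
def subst (θ : Var → Val) : Val → Val
  | var x => θ x
  | bool b => bool b

end Val

/-- Lifting of a renaming below a binder of `n` variables. -/
def liftRen (n : ℕ) (f : Var → Var) (j : Var) : Var :=
  if j < n then j else f (j - n) + n

/-- Lifting of a substitution below a binder of `n` variables. -/
def liftSub (n : ℕ) (θ : Var → Val) (j : Var) : Val :=
  if j < n then .var j else (θ (j - n)).rename (· + n)

/-- The renaming that turns the free variables `xs 0, …, xs (n-1)` (distinct) into the bound
variables `0, …, n-1` of a new binder around the term. -/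
noncomputable def closeMap {n : ℕ} (xs : Fin n → Var) : Var → Var :=
  Function.extend xs (fun i => (i : ℕ)) (fun z => z + n)

/-- The substitution that removes a binder of `n` variables and replaces them by `vs`. -/
def instMap {n : ℕ} (vs : Fin n → Val) (j : Var) : Val :=
  if h : j < n then vs ⟨j, h⟩ else .var (j - n)

/-- Trace sets `Φ`: prefix-closed sets of sequences of access labels. -/
structure TraceSet (Acc : Type u) where
  carrier : Set (List Acc)
  prefix_closed : ∀ s t, s ++ t ∈ carrier → s ∈ carrier

/-- `Φ^{-ξ} = {s | ξ s ∈ Φ}`. -/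
def TraceSet.after {Acc : Type u} (Φ : TraceSet Acc) (ξ : Acc) : TraceSet Acc where
  carrier := {s | ξ :: s ∈ Φ.carrier}
  prefix_closed := fun s t h => Φ.prefix_closed (ξ :: s) t h

/-! ## Processes -/

/-- Processes.  The subjects of prefixes are values because a substitution may put a boolean
there; a prefix whose subject is a boolean is neither typable nor able to act. -/
inductive Proc (Acc : Type u) : Type u where
  /-- the inactive process `0` -/
  | zero : Proc Acc
  /-- output `x⟨v₁, …, vₙ⟩. P` -/
  | out (x : Val) {n : ℕ} (vs : Fin n → Val) (P : Proc Acc) : Proc Acc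
  /-- input `x(y₁, …, yₙ). P`, which binds `n` variables in `P` -/
  | inp (x : Val) (n : ℕ) (P : Proc Acc) : Proc Acc
  /-- `P | Q` -/
  | par (P Q : Proc Acc) : Proc Acc
  /-- `if v then P else Q` -/
  | ite (v : Val) (P Q : Proc Acc) : Proc Acc
  /-- channel creation `(ν x) P`, which binds one variable in `P` -/
  | nu (P : Proc Acc) : Proc Acc
  /-- replication `*P` -/
  | rep (P : Proc Acc) : Proc Acc
  /-- access `acc_ξ(x). P` to the resource `x` -/
  | acc (ξ : Acc) (x : Val) (P : Proc Acc) : Proc Acc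
  /-- creation `(𝔑^Φ x) P` of a resource to be used according to `Φ`; binds one variable in `P` -/
  | nuR (Φ : TraceSet Acc) (P : Proc Acc) : Proc Acc

namespace Proc

variable {Acc : Type u}

/-- Capture-avoiding simultaneous substitution of values for variables. -/
def subst : (Var → Val) → Proc Acc → Proc Acc
  | _, zero => zero
  | θ, out x vs P => out (x.subst θ) (fun i => (vs i).subst θ) (P.subst θ)
  | θ, inp x n P => inp (x.subst θ) n (P.subst (liftSub n θ))
  | θ, par P Q => par (P.subst θ) (Q.subst θ)
  | θ, ite v P Q => ite (v.subst θ) (P.subst θ) (Q.subst θ)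
  | θ, nu P => nu (P.subst (liftSub 1 θ))
  | θ, rep P => rep (P.subst θ)
  | θ, acc ξ x P => acc ξ (x.subst θ) (P.subst θ)
  | θ, nuR Φ P => nuR Φ (P.subst (liftSub 1 θ))

/-- Renaming of free variables. -/
def rename (f : Var → Var) (P : Proc Acc) : Proc Acc :=
  P.subst (fun x => .var (f x))

end Proc

/-- The structural preorder `P ≼ Q`.  In `new` and `newR` the process `Q` is shifted below the
binder, so the bound variable is not free in it. -/
inductive SPre {Acc : Type u} : Proc Acc → Proc Acc → Prop where
  | refl (P) : SPre P P
  | trans {P Q R} : SPre P Q → SPre Q R → SPre P R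
  | zero (P) : SPre (.par P .zero) P
  | zero' (P) : SPre P (.par P .zero)
  | comm (P Q) : SPre (.par P Q) (.par Q P)
  | assoc (P Q R) : SPre (.par P (.par Q R)) (.par (.par P Q) R)
  | assoc' (P Q R) : SPre (.par (.par P Q) R) (.par P (.par Q R))
  | rep (P) : SPre (.rep P) (.par (.rep P) P)
  | new (P Q) : SPre (.par (.nu P) Q) (.nu (.par P (Q.rename (· + 1))))
  | newR (Φ P Q) : SPre (.par (.nuR Φ P) Q) (.nuR Φ (.par P (Q.rename (· + 1))))
  | par {P P' Q Q'} : SPre P P' → SPre Q Q' → SPre (.par P Q) (.par P' Q')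
  | cnew {P Q} : SPre P Q → SPre (.nu P) (.nu Q)
  | cnewR {Φ P Q} : SPre P Q → SPre (.nuR Φ P) (.nuR Φ Q)

/-- Reduction labels `L ::= x^ξ | τ`. -/
inductive RLabel (Acc : Type u) : Type u where
  | acc (x : Var) (ξ : Acc) : RLabel Acc
  | tau : RLabel Acc

/-- Renaming of reduction labels. -/
def RLabel.rename {Acc : Type u} (f : Var → Var) : RLabel Acc → RLabel Acc
  | acc x ξ => acc (f x) ξ
  | tau => tau

/-- The labelled reduction relation `P ⟶[L] P'`.  In `new` and `newR2` the label below the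
binder is the shifted label, so the bound variable is not its target; in `newR1` the accessed
resource is the bound variable. -/
inductive Red {Acc : Type u} : Proc Acc → RLabel Acc → Proc Acc → Prop where
  | com (x : Var) {n : ℕ} (vs : Fin n → Val) (P Q) :
      Red (.par (.out (.var x) vs P) (.inp (.var x) n Q)) .tau (.par P (Q.subst (instMap vs)))
  | acc (ξ x P) : Red (.acc ξ (.var x) P) (.acc x ξ) P
  | par {P L P'} (Q) : Red P L P' → Red (.par P Q) L (.par P' Q)
  | iteT (P Q) : Red (.ite (.bool true) P Q) .tau P
  | iteF (P Q) : Red (.ite (.bool false) P Q) .tau Q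
  | new {P L P'} : Red P (L.rename (· + 1)) P' → Red (.nu P) L (.nu P')
  | newR1 {Φ P ξ P'} : Red P (.acc 0 ξ) P' → Red (.nuR Φ P) .tau (.nuR (Φ.after ξ) P')
  | newR2 {Φ P L P'} : Red P (L.rename (· + 1)) P' → Red (.nuR Φ P) L (.nuR Φ P')
  | sp {P Q L Q' P'} : SPre P Q → Red Q L Q' → SPre Q' P' → Red P L P'

/-! ## Behavioural types -/

/-- Communication actions `a ::= x | x̄ | τ`. -/
inductive Act where
  | inp (x : Var)
  | out (x : Var)
  | tau

/-- Behavioural types with `k` free recursion variables.  Recursion variables have binders and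
de Bruijn indices of their own. -/
inductive Beh (Acc : Type u) : ℕ → Type u where
  /-- `0` -/
  | zero {k : ℕ} : Beh Acc k
  /-- a recursion variable `α` -/
  | rvar {k : ℕ} (i : Fin k) : Beh Acc k
  /-- `a. A` -/
  | pre {k : ℕ} (a : Act) (A : Beh Acc k) : Beh Acc k
  /-- `x^ξ. A` -/
  | acc {k : ℕ} (x : Var) (ξ : Acc) (A : Beh Acc k) : Beh Acc k
  /-- `A | B` -/
  | par {k : ℕ} (A B : Beh Acc k) : Beh Acc k
  /-- `A ⊕ B` -/
  | choice {k : ℕ} (A B : Beh Acc k) : Beh Acc k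
  /-- `*A` -/
  | rep {k : ℕ} (A : Beh Acc k) : Beh Acc k
  /-- the delayed simultaneous substitution `⟨v₁/x₁, …, vₙ/xₙ⟩ A`, given by the pairs `(xᵢ, vᵢ)` -/
  | sub {k : ℕ} (θ : List (Var × Val)) (A : Beh Acc k) : Beh Acc k
  /-- `(ν x) A`, which binds one variable in `A` -/
  | nu {k : ℕ} (A : Beh Acc k) : Beh Acc k
  /-- `μ α. A` -/
  | mu {k : ℕ} (A : Beh Acc (k + 1)) : Beh Acc k
  /-- exclusion `A ↑ S` -/
  | excl {k : ℕ} (A : Beh Acc k) (S : Finset Var) : Beh Acc k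
  /-- projection `A ↓ S` -/
  | proj {k : ℕ} (A : Beh Acc k) (S : Finset Var) : Beh Acc k

/-- Renaming of actions. -/
def Act.rename (f : Var → Var) : Act → Act
  | inp x => inp (f x)
  | out x => out (f x)
  | tau => tau

namespace Beh

variable {Acc : Type u}

/-- Renaming of variables.  It is only ever used with injective `f`, where it is the evident
renaming; the variables in a delayed substitution and in the sets `S` are renamed too. -/
def rename : {k : ℕ} → (Var → Var) → Beh Acc k → Beh Acc k
  | _, _, zero => zero
  | _, _, rvar i => rvar i
  | _, f, pre a A => pre (a.rename f) (A.rename f)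
  | _, f, acc x ξ A => acc (f x) ξ (A.rename f)
  | _, f, par A B => par (A.rename f) (B.rename f)
  | _, f, choice A B => choice (A.rename f) (B.rename f)
  | _, f, rep A => rep (A.rename f)
  | _, f, sub θ A => sub (θ.map fun p => (f p.1, p.2.rename f)) (A.rename f)
  | _, f, nu A => nu (A.rename (liftRen 1 f))
  | _, f, mu A => mu (A.rename f)
  | _, f, excl A S => excl (A.rename f) (S.image f)
  | _, f, proj A S => proj (A.rename f) (S.image f)

/-- Renaming of recursion variables. -/
def rrename : {k m : ℕ} → (Fin k → Fin m) → Beh Acc k → Beh Acc m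
  | _, _, _, zero => zero
  | _, _, ρ, rvar i => rvar (ρ i)
  | _, _, ρ, pre a A => pre a (A.rrename ρ)
  | _, _, ρ, acc x ξ A => acc x ξ (A.rrename ρ)
  | _, _, ρ, par A B => par (A.rrename ρ) (B.rrename ρ)
  | _, _, ρ, choice A B => choice (A.rrename ρ) (B.rrename ρ)
  | _, _, ρ, rep A => rep (A.rrename ρ)
  | _, _, ρ, sub θ A => sub θ (A.rrename ρ)
  | _, _, ρ, nu A => nu (A.rrename ρ)
  | _, _, ρ, mu A => mu (A.rrename (Fin.cases 0 fun i => (ρ i).succ))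
  | _, _, ρ, excl A S => excl (A.rrename ρ) S
  | _, _, ρ, proj A S => proj (A.rrename ρ) S

/-- Substitution of behavioural types for recursion variables.  It does not capture under
`(ν x)` or `μ α`; a delayed substitution acts on whatever is put below it. -/
def rsubst : {k m : ℕ} → (Fin k → Beh Acc m) → Beh Acc k → Beh Acc m
  | _, _, _, zero => zero
  | _, _, σ, rvar i => σ i
  | _, _, σ, pre a A => pre a (A.rsubst σ)
  | _, _, σ, acc x ξ A => acc x ξ (A.rsubst σ)
  | _, _, σ, par A B => par (A.rsubst σ) (B.rsubst σ)
  | _, _, σ, choice A B => choice (A.rsubst σ) (B.rsubst σ)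
  | _, _, σ, rep A => rep (A.rsubst σ)
  | _, _, σ, sub θ A => sub θ (A.rsubst σ)
  | _, _, σ, nu A => nu (A.rsubst fun i => (σ i).rename (· + 1))
  | _, _, σ, mu A => mu (A.rsubst (Fin.cases (rvar 0) fun i => (σ i).rrename Fin.succ))
  | _, _, σ, excl A S => excl (A.rsubst σ) S
  | _, _, σ, proj A S => proj (A.rsubst σ) S

/-- `[μ α. A / α] A`. -/
def unfold (A : Beh Acc 1) : Beh Acc 0 :=
  A.rsubst fun _ => mu A

end Beh

/-- The variable of an action. -/
def Act.fv : Act → Finset Var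
  | .inp x => {x}
  | .out x => {x}
  | .tau => ∅

/-- The domain `{x₁, …, xₙ}` of `⟨v₁/x₁, …, vₙ/xₙ⟩`. -/
def subDom (θ : List (Var × Val)) : Finset Var :=
  (θ.map Prod.fst).toFinset

/-- The variables among `v₁, …, vₙ` in `⟨v₁/x₁, …, vₙ/xₙ⟩`. -/
def subRange (θ : List (Var × Val)) : Finset Var :=
  (θ.filterMap fun p => p.2.var?).toFinset

/-- Free variables of a behavioural type. -/
def Beh.fv {Acc : Type u} : {k : ℕ} → Beh Acc k → Finset Var
  | _, .zero => ∅
  | _, .rvar _ => ∅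
  | _, .pre a A => a.fv ∪ A.fv
  | _, .acc x _ A => insert x A.fv
  | _, .par A B => A.fv ∪ B.fv
  | _, .choice A B => A.fv ∪ B.fv
  | _, .rep A => A.fv
  | _, .sub θ A => (A.fv \ subDom θ) ∪ subRange θ
  | _, .nu A => (A.fv.erase 0).image (· - 1)
  | _, .mu A => A.fv
  | _, .excl A S => A.fv \ S
  | _, .proj A S => A.fv ∩ S

/-- Transition labels `l ::= x | x̄ | τ | x^ξ | {x, ȳ}`. -/
inductive Label (Acc : Type u) : Type u where
  | inp (x : Var) : Label Acc
  | out (x : Var) : Label Acc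
  | tau : Label Acc
  | acc (x : Var) (ξ : Acc) : Label Acc
  | com (x y : Var) : Label Acc

namespace Label

variable {Acc : Type u}

/-- The label of an action. -/
def ofAct : Act → Label Acc
  | .inp x => inp x
  | .out x => out x
  | .tau => tau

/-- A reduction label as a transition label. -/
def ofRLabel : RLabel Acc → Label Acc
  | .acc x ξ => acc x ξ
  | .tau => tau

/-- Renaming of labels. -/
def rename (f : Var → Var) : Label Acc → Label Acc
  | inp x => inp (f x)
  | out x => out (f x)
  | tau => tau
  | acc x ξ => acc (f x) ξ
  | com x y => com (f x) (f y)

/-- `target(l)`. -/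
def target : Label Acc → Finset Var
  | inp x => {x}
  | out x => {x}
  | tau => ∅
  | acc x _ => {x}
  | com x y => {x, y}

/-- `[v₁/x₁, …, vₙ/xₙ] l`.  There is no action on a boolean, so the result is undefined if a
variable of `l` is replaced by one. -/
def subst (θ : Var → Val) : Label Acc → Option (Label Acc)
  | inp x => (θ x).var?.map inp
  | out x => (θ x).var?.map out
  | tau => some tau
  | acc x ξ => (θ x).var?.map (acc · ξ)
  | com x y => Option.map₂ com (θ x).var? (θ y).var?

end Label

/-- The function of a finite substitution: `xᵢ ↦ vᵢ`, and every other variable to itself. -/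
def subFun (θ : List (Var × Val)) (x : Var) : Val :=
  (θ.lookup x).getD (.var x)

/-- The transition relation `A ⟶[l] A'` of (closed) behavioural types.  In `new` the label below
the binder is the shifted label, so the bound variable is not in its target. -/
inductive Step {Acc : Type u} : Beh Acc 0 → Label Acc → Beh Acc 0 → Prop where
  | act (a A) : Step (.pre a A) (.ofAct a) A
  | acc (x ξ A) : Step (.acc x ξ A) (.acc x ξ) A
  | parL {A l A'} (B) : Step A l A' → Step (.par A B) l (.par A' B)
  | parR {B l B'} (A) : Step B l B' → Step (.par A B) l (.par A B')
  | comL {A B A' B' x y} : Step A (.inp x) A' → Step B (.out y) B' →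
      Step (.par A B) (.com x y) (.par A' B')
  | comR {A B A' B' x y} : Step A (.out y) A' → Step B (.inp x) B' →
      Step (.par A B) (.com x y) (.par A' B')
  | tau {A A' x} : Step A (.com x x) A' → Step A .tau A'
  | choiceL {A l A'} (B) : Step A l A' → Step (.choice A B) l A'
  | choiceR {B l B'} (A) : Step B l B' → Step (.choice A B) l B'
  | rep {A l A'} : Step (.par A (.rep A)) l A' → Step (.rep A) l A'
  | mu {A l A'} : Step A.unfold l A' → Step (.mu A) l A'
  | sub {θ A l l' A'} : Step A l A' → l.subst (subFun θ) = some l' →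
      Step (.sub θ A) l' (.sub θ A')
  | new {A l A'} : Step A (l.rename (· + 1)) A' → Step (.nu A) l (.nu A')
  | exclIn {A l A' S} : Step A l A' → l.target ⊆ S → Step (.excl A S) .tau (.excl A' S)
  | exclOut {A l A' S} : Step A l A' → Disjoint l.target S → Step (.excl A S) l (.excl A' S)
  | projIn {A l A' S} : Step A l A' → l.target ⊆ S → Step (.proj A S) l (.proj A' S)
  | projOut {A l A' S} : Step A l A' → Disjoint l.target S → Step (.proj A S) .tau (.proj A' S)

/-- `A ⟹ A'`: the reflexive and transitive closure of the `τ`-transitions. -/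
def TauSteps {Acc : Type u} : Beh Acc 0 → Beh Acc 0 → Prop :=
  Relation.ReflTransGen fun A B => Step A .tau B

/-- The weak transition `A ⟹[l] A'`: this is `A ⟹ A'` (possibly no step) if `l = τ`, and
`A ⟹ ⟶[l] ⟹ A'` otherwise. -/
def WStep {Acc : Type u} (A : Beh Acc 0) (l : Label Acc) (A' : Beh Acc 0) : Prop :=
  (l = .tau ∧ TauSteps A A') ∨
    (l ≠ .tau ∧ ∃ B C, TauSteps A B ∧ Step B l C ∧ TauSteps C A')

/-- `R` is a simulation; `R A B` says that `A` simulates `B`. -/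
def IsSimulation {Acc : Type u} (R : Beh Acc 0 → Beh Acc 0 → Prop) : Prop :=
  ∀ A B, R A B → ∀ l B', Step B l B' → ∃ A', WStep A l A' ∧ R A' B'

/-- The simulation preorder `A ≥ B`: the largest simulation. -/
def Sim {Acc : Type u} (A B : Beh Acc 0) : Prop :=
  ∃ R : Beh Acc 0 → Beh Acc 0 → Prop, IsSimulation R ∧ R A B

/-- `WTrace x A s`: from `A` there are weak transitions `x^ξ₁, …, x^ξₙ`, where `s = ξ₁ … ξₙ`. -/
inductive WTrace {Acc : Type u} (x : Var) : Beh Acc 0 → List Acc → Prop where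
  | nil (A) : WTrace x A []
  | cons {A ξ A' s} : WStep A (.acc x ξ) A' → WTrace x A' s → WTrace x A (ξ :: s)

/-- `traces_x(A)`: the sequences of accesses to `x` that `A ↓ {x}` can perform. -/
def traces {Acc : Type u} (x : Var) (A : Beh Acc 0) : Set (List Acc) :=
  {s | WTrace x (.proj A {x}) s}

/-! ## The type system -/

/-- Value types.  In `chan n τ A`, the type `chan⟨(y₁ : τ₁, …, yₙ : τₙ) A⟩`, the parameters are
bound in `A` and named `0, …, n-1`; no other variable is free in `A`. -/
inductive VTy (Acc : Type u) : Type u where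
  | bool : VTy Acc
  | res : VTy Acc
  | chan (n : ℕ) (τ : Fin n → VTy Acc) (A : Beh Acc 0) (hA : A.fv ⊆ Finset.range n) : VTy Acc

/-- Type environments; `Γ x = none` if `x` is not in the domain. -/
abbrev Ctx (Acc : Type u) := Var → Option (VTy Acc)

/-- `Γ, x₁ : τ₁, …, xₙ : τₙ` for distinct `xᵢ`. -/
noncomputable def Ctx.extend {Acc : Type u} (Γ : Ctx Acc) {n : ℕ} (xs : Fin n → Var)
    (τ : Fin n → VTy Acc) : Ctx Acc :=
  Function.extend xs (fun i => some (τ i)) Γ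

/-- Typing of values, `Γ ▷ v : τ`. -/
inductive HasVTy {Acc : Type u} (Γ : Ctx Acc) : Val → VTy Acc → Prop where
  | var {x τ} : Γ x = some τ → HasVTy Γ (.var x) τ
  | bool (b) : HasVTy Γ (.bool b) .bool

/-- `⟨v₁/y₁, …, vₙ/yₙ⟩ A` for the behaviour `A` of a channel type with parameters
`yᵢ = i - 1`. -/
def Beh.inst {Acc : Type u} {n : ℕ} (vs : Fin n → Val) (A : Beh Acc 0) : Beh Acc 0 :=
  .sub (List.ofFn fun i => ((i : ℕ), vs i)) A

/-- The typing judgement `Γ ▷ P : A`.  The variables that are added to an environment are not in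
its domain.  `P.rename (closeMap xs)` under a binder is `P` with the variables `xs` bound, and
`A₁.inst ys` is the behaviour `A₁` of a channel type with its bound parameters named `ys`. -/
inductive Typed {Acc : Type u} : Ctx Acc → Proc Acc → Beh Acc 0 → Prop where
  | zero (Γ) : Typed Γ .zero .zero
  | out {Γ : Ctx Acc} {x : Var} {n τ A₁ hA} {vs : Fin n → Val} {P A₂} :
      Typed Γ P A₂ → HasVTy Γ (.var x) (.chan n τ A₁ hA) → (∀ i, HasVTy Γ (vs i) (τ i)) →
      Typed Γ (.out (.var x) vs P) (.pre (.out x) (.par (A₁.inst vs) A₂))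
  | inp {Γ : Ctx Acc} {x : Var} {n τ A₁ hA} {ys : Fin n → Var} {P A₂} :
      Function.Injective ys → (∀ i, Γ (ys i) = none) →
      Typed (Γ.extend ys τ) P A₂ → HasVTy Γ (.var x) (.chan n τ A₁ hA) →
      Sim (A₁.inst fun i => .var (ys i)) (.proj A₂ (Finset.univ.image ys)) →
      Typed Γ (.inp (.var x) n (P.rename (closeMap ys)))
        (.pre (.inp x) (.excl A₂ (Finset.univ.image ys)))
  | par {Γ P Q A B} : Typed Γ P A → Typed Γ Q B → Typed Γ (.par P Q) (.par A B)
  | ite {Γ v P Q A} : HasVTy Γ v .bool → Typed Γ P A → Typed Γ Q A → Typed Γ (.ite v P Q) A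
  | rep {Γ P A} : Typed Γ P A → Typed Γ (.rep P) (.rep A)
  | new {Γ : Ctx Acc} {x n τ B hB P A} : Γ x = none →
      Typed (Γ.extend ![x] ![.chan n τ B hB]) P A →
      Typed Γ (.nu (P.rename (closeMap ![x]))) (.nu (A.rename (closeMap ![x])))
  | acc {Γ : Ctx Acc} {x ξ P A} : Typed Γ P A → HasVTy Γ (.var x) .res →
      Typed Γ (.acc ξ (.var x) P) (.acc x ξ A)
  | newR {Γ : Ctx Acc} {x Φ P A} : Γ x = none → Typed (Γ.extend ![x] ![.res]) P A →
      traces x A ⊆ Φ.carrier →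
      Typed Γ (.nuR Φ (P.rename (closeMap ![x]))) (.excl A {x})
  | sub {Γ P A' A} : Typed Γ P A' → Sim A A' → Typed Γ P A

end ResPi

namespace ResPi

universe u

variable {Acc : Type u}

/-! ## Substitution in processes -/

/-! The proof is an induction on the reduction (`Red.typed`). Because of subsumption, inverting a
typing derivation determines the type only up to `Sim`. As `Sim` is a weak simulation preorder, it
is enough to let the type given by the syntax-directed rule make the move, and then to transport
that move along `Sim`.

Communication is the heart of the matter. The sender has type x̄.(⟨ṽ/ỹ⟩A₁ | A₂) and the receiver
x.(A₃↑ỹ), with A₁ ≥ A₃↓ỹ. The τ-step leaves ⟨ṽ/ỹ⟩A₁, A₂ and A₃↑ỹ, whereas the substitution lemma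
`Typed.subst` types the instantiated receiver with ⟨ṽ/ỹ⟩A₃. The gap is closed by ⟨ṽ/ỹ⟩(A₃↓ỹ) | A₃↑ỹ
≥ ⟨ṽ/ỹ⟩A₃ (`Sim.proj_par_excl`): each half shows the actions on its own variables and follows the
others by τ. A communication with one end in ỹ is first split into two consecutive actions
(`Step.com_split`), on which the halves then synchronise.

The substitution lemma requires that pushing a delayed substitution inwards gives a smaller type.
For `|` and `*` this is `PushSub.sim`; where a bound variable is renamed to a fresh one it is
`Sim.excl_sub`, `Sim.proj_sub` and `Sim.nu_sub`. The structural preorder (`SPre.typed`) rests on the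
monoid laws of `|` up to `Sim` and on the scope extrusion laws `Sim.par_nu`, `Sim.par_excl` and
`Sim.proj_par`. For a resource, traces are monotone along `Sim`, and an access ξ that leads to A'
puts ξs among the traces of the type before it for each trace s of A'.

Bodies of de Bruijn binders are opened with large, hence fresh, variables. For that reason the
inductive statements speak about all substitution or renaming instances of a process. -/

theorem liftSub_comp (n : ℕ) (θ η : Var → Val) (j : Var) :
    (liftSub n θ j).subst (liftSub n η) = liftSub n (fun x => (θ x).subst η) j := by
  unfold liftSub
  split
  · simp [Val.subst, *]
  · rcases hθ : θ (j - n) with w | b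
    · simp [Val.rename, Val.subst, hθ]
    · simp [Val.rename, Val.subst, hθ]

theorem Val.subst_subst (θ η : Var → Val) (v : Val) :
    (v.subst θ).subst η = v.subst (fun x => (θ x).subst η) := by
  cases v <;> rfl

theorem Val.rename_eq_subst (f : Var → Var) (v : Val) :
    v.rename f = v.subst fun x => .var (f x) := by
  cases v <;> rfl

theorem liftSub_var (n : ℕ) : liftSub n Val.var = Val.var := by
  funext j
  unfold liftSub
  split
  · rfl
  · rename_i h
    simp only [Val.rename, Val.var.injEq]
    exact Nat.sub_add_cancel (not_lt.mp h)

theorem Val.subst_var (v : Val) : v.subst Val.var = v := by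
  cases v <;> rfl

namespace Proc

theorem subst_subst (P : Proc Acc) (θ η : Var → Val) :
    (P.subst θ).subst η = P.subst (fun x => (θ x).subst η) := by
  induction P generalizing θ η with
  | zero => rfl
  | out x vs P ih => simp [subst, ih, Val.subst_subst]
  | inp x n P ih => simp [subst, ih, Val.subst_subst, liftSub_comp]
  | par P Q ihP ihQ => simp [subst, ihP, ihQ]
  | ite v P Q ihP ihQ => simp [subst, ihP, ihQ, Val.subst_subst]
  | nu P ih => simp [subst, ih, liftSub_comp]
  | rep P ih => simp [subst, ih]
  | acc ξ x P ih => simp [subst, ih, Val.subst_subst]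
  | nuR Φ P ih => simp [subst, ih, liftSub_comp]

theorem subst_var (P : Proc Acc) : P.subst Val.var = P := by
  induction P with
  | zero => rfl
  | out x vs P ih => simp [subst, ih, Val.subst_var]
  | inp x n P ih => simp [subst, ih, Val.subst_var, liftSub_var]
  | par P Q ihP ihQ => simp [subst, ihP, ihQ]
  | ite v P Q ihP ihQ => simp [subst, ihP, ihQ, Val.subst_var]
  | nu P ih => simp [subst, ih, liftSub_var]
  | rep P ih => simp [subst, ih]
  | acc ξ x P ih => simp [subst, ih, Val.subst_var]
  | nuR Φ P ih => simp [subst, ih, liftSub_var]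

end Proc

/-- A strict upper bound of the variable of a value. -/
def Val.bd : Val → ℕ
  | var x => x + 1
  | bool _ => 0

/-- A strict upper bound of the free variables of a process. -/
def Proc.bd : Proc Acc → ℕ
  | zero => 0
  | out x vs P => max x.bd (max (Finset.univ.sup fun i => (vs i).bd) P.bd)
  | inp x n P => max x.bd (P.bd - n)
  | par P Q => max P.bd Q.bd
  | ite v P Q => max v.bd (max P.bd Q.bd)
  | nu P => P.bd - 1
  | rep P => P.bd
  | acc _ x P => max x.bd P.bd
  | nuR _ P => P.bd - 1

theorem Val.subst_congr {θ η : Var → Val} (v : Val) (h : ∀ z < v.bd, θ z = η z) :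
    v.subst θ = v.subst η := by
  cases v with
  | var x => exact h x (Nat.lt_succ_self x)
  | bool b => rfl

theorem liftSub_congr {θ η : Var → Val} {n N : ℕ} (h : ∀ z < N - n, θ z = η z) :
    ∀ z < N, liftSub n θ z = liftSub n η z := by
  intro z hz
  unfold liftSub
  split
  · rfl
  · rename_i hn
    rw [h _ (Nat.sub_lt_sub_right (not_lt.mp hn) hz)]

theorem Proc.subst_congr {θ η : Var → Val} (P : Proc Acc) (h : ∀ z < P.bd, θ z = η z) :
    P.subst θ = P.subst η := by
  induction P generalizing θ η with
  | zero => rfl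
  | out x vs P ih =>
    simp only [bd, lt_max_iff] at h
    simp only [subst]
    rw [ih fun z hz => h z (.inr (.inr hz)), x.subst_congr fun z hz => h z (.inl hz)]
    congr 1
    funext i
    exact (vs i).subst_congr fun z hz => h z
      (.inr (.inl (lt_of_lt_of_le hz (Finset.le_sup (f := fun i => (vs i).bd) (Finset.mem_univ i)))))
  | inp x n P ih =>
    simp only [bd, lt_max_iff] at h
    simp only [subst]
    rw [ih (liftSub_congr fun z hz => h z (.inr hz)), x.subst_congr fun z hz => h z (.inl hz)]
  | par P Q ihP ihQ =>
    simp only [bd, lt_max_iff] at h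
    simp only [subst]
    rw [ihP fun z hz => h z (.inl hz), ihQ fun z hz => h z (.inr hz)]
  | ite v P Q ihP ihQ =>
    simp only [bd, lt_max_iff] at h
    simp only [subst]
    rw [ihP fun z hz => h z (.inr (.inl hz)), ihQ fun z hz => h z (.inr (.inr hz)),
      v.subst_congr fun z hz => h z (.inl hz)]
  | nu P ih => simp only [subst]; rw [ih (liftSub_congr h)]
  | rep P ih => simp only [subst]; rw [ih h]
  | acc ξ x P ih =>
    simp only [bd, lt_max_iff] at h
    simp only [subst]
    rw [ih fun z hz => h z (.inr hz), x.subst_congr fun z hz => h z (.inl hz)]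
  | nuR Φ P ih => simp only [subst]; rw [ih (liftSub_congr h)]

/-! ### Opening and closing binders. -/

theorem closeMap_apply {n : ℕ} {xs : Fin n → Var} (h : Function.Injective xs) (i : Fin n) :
    closeMap xs (xs i) = i := h.extend_apply _ _ i

theorem closeMap_apply' {n : ℕ} {xs : Fin n → Var} {z : Var} (h : ∀ i, xs i ≠ z) :
    closeMap xs z = z + n := Function.extend_apply' _ _ _ (by simpa using h)

theorem closeMap_injective {n : ℕ} {xs : Fin n → Var} (h : Function.Injective xs) :
    Function.Injective (closeMap xs) := by
  intro a b hab
  by_cases ha : ∃ i, xs i = a <;> by_cases hb : ∃ i, xs i = b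
  · obtain ⟨i, rfl⟩ := ha
    obtain ⟨j, rfl⟩ := hb
    rw [closeMap_apply h, closeMap_apply h] at hab
    rw [Fin.ext hab]
  · obtain ⟨i, rfl⟩ := ha
    rw [closeMap_apply h, closeMap_apply' (not_exists.mp hb)] at hab
    exact absurd (hab ▸ i.2) (Nat.not_lt.mpr (Nat.le_add_left n b))
  · obtain ⟨i, rfl⟩ := hb
    rw [closeMap_apply h, closeMap_apply' (not_exists.mp ha)] at hab
    exact absurd (hab.symm ▸ i.2) (Nat.not_lt.mpr (Nat.le_add_left n a))
  · rw [closeMap_apply' (not_exists.mp ha), closeMap_apply' (not_exists.mp hb)] at hab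
    exact Nat.add_right_cancel hab

theorem instMap_lt {n : ℕ} (vs : Fin n → Val) (i : Fin n) : instMap vs i = vs i := by
  simp [instMap]

theorem instMap_add {n : ℕ} (vs : Fin n → Val) (z : ℕ) : instMap vs (z + n) = .var z := by
  simp [instMap]

theorem singleton_injective (x : Var) : Function.Injective ![x] :=
  Function.injective_of_subsingleton _

/-- Closing a process over fresh variables undoes opening it with them. -/
theorem Proc.close_open {n : ℕ} (P : Proc Acc) {ys : Fin n → Var} (hy : Function.Injective ys)
    (h : ∀ i, P.bd ≤ ys i + n) :
    (P.subst (instMap fun i => .var (ys i))).rename (closeMap ys) = P := by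
  conv_rhs => rw [← P.subst_var]
  rw [Proc.rename, Proc.subst_subst]
  refine P.subst_congr fun z hz => ?_
  by_cases hzn : z < n
  · have := instMap_lt (fun i => Val.var (ys i)) ⟨z, hzn⟩
    simp only at this
    simp [this, Val.subst, closeMap_apply hy]
  · obtain ⟨w, rfl⟩ := Nat.exists_eq_add_of_le' (not_lt.mp hzn)
    -- The outer variable w appears below the binder as w + n < `P.bd`, and `P.bd` ≤ ys i + n; so w
    -- is none of the ys.
    rw [instMap_add, Val.subst, closeMap_apply']
    intro i hi
    have := h i
    rw [hi] at this
    exact absurd hz (not_lt.mpr this)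

/-- Instantiating a process that is closed over `ys` is substitution for `ys`. -/
theorem Proc.open_close {n : ℕ} (P : Proc Acc) {ys : Fin n → Var} (hy : Function.Injective ys)
    (vs : Fin n → Val) {θ : Var → Val} (h1 : ∀ i, θ (ys i) = vs i)
    (h2 : ∀ z, (∀ i, ys i ≠ z) → θ z = .var z) :
    (P.rename (closeMap ys)).subst (instMap vs) = P.subst θ := by
  rw [Proc.rename, Proc.subst_subst]
  congr 1
  funext z
  by_cases hz : ∃ i, ys i = z
  · obtain ⟨i, rfl⟩ := hz
    rw [closeMap_apply hy, Val.subst, instMap_lt, h1]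
  · rw [closeMap_apply' (not_exists.mp hz), Val.subst, instMap_add, h2 _ (not_exists.mp hz)]

/-- Substitution below a binder, whose variables are renamed from `ys` to `ys'`. -/
theorem Proc.close_subst {n : ℕ} (P : Proc Acc) {ys ys' : Fin n → Var}
    (hy : Function.Injective ys) (hy' : Function.Injective ys') {θ θ' : Var → Val}
    (h1 : ∀ i, θ' (ys i) = .var (ys' i)) (h2 : ∀ z, (∀ i, ys i ≠ z) → θ' z = θ z)
    (h3 : ∀ z < P.bd, (∀ i, ys i ≠ z) → ∀ i, θ z ≠ .var (ys' i)) :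
    (P.rename (closeMap ys)).subst (liftSub n θ) = (P.subst θ').rename (closeMap ys') := by
  rw [Proc.rename, Proc.rename, Proc.subst_subst, Proc.subst_subst]
  refine P.subst_congr fun z hz => ?_
  by_cases hzy : ∃ i, ys i = z
  · obtain ⟨i, rfl⟩ := hzy
    simp [closeMap_apply hy, h1, Val.subst, closeMap_apply hy', liftSub]
  · have h3 := h3 z hz (not_exists.mp hzy)
    rw [closeMap_apply' (not_exists.mp hzy), h2 _ (not_exists.mp hzy)]
    cases hθ : θ z with
    | var w =>
      rw [hθ] at h3
      rw [Val.subst, Val.subst, closeMap_apply' (fun i hi => h3 i (by rw [hi]))]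
      simp [liftSub, hθ, Val.rename]
    | bool b => simp [liftSub, hθ, Val.rename, Val.subst]

theorem Proc.shift_subst (P : Proc Acc) (θ : Var → Val) :
    (P.rename (· + 1)).subst (liftSub 1 θ) = (P.subst θ).rename (· + 1) := by
  rw [Proc.rename, Proc.rename, Proc.subst_subst, Proc.subst_subst]
  refine P.subst_congr fun z _ => ?_
  simp [Val.subst, liftSub, Val.rename_eq_subst]

theorem Proc.shift_inst (P : Proc Acc) (vs : Fin 1 → Val) :
    (P.rename (· + 1)).subst (instMap vs) = P := by
  rw [Proc.rename, Proc.subst_subst]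
  conv_rhs => rw [← P.subst_var]
  rfl

theorem Proc.subst_inst (P : Proc Acc) {n : ℕ} (vs : Fin n → Val) (θ : Var → Val) :
    (P.subst (instMap vs)).subst θ =
      (P.subst (liftSub n θ)).subst (instMap fun i => (vs i).subst θ) := by
  rw [Proc.subst_subst, Proc.subst_subst]
  congr 1
  funext z
  by_cases hz : z < n
  · simp [instMap, hz, liftSub, Val.subst]
  · obtain ⟨w, rfl⟩ := Nat.exists_eq_add_of_le' (not_lt.mp hz)
    rw [instMap_add]
    simp only [liftSub, hz, if_false, Nat.add_sub_cancel]
    cases h : θ w <;> simp [Val.rename, Val.subst, h, instMap_add]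

/-! ## Labels -/

theorem Val.var?_eq_some {v : Val} {x : Var} : v.var? = some x ↔ v = .var x := by
  cases v <;> simp [Val.var?]

namespace Label

/-- `l'` is `l`, or `l` is a communication on one channel and `l'` is `τ`. -/
def Contracts (l l' : Label Acc) : Prop :=
  l = l' ∨ (l' = tau ∧ ∃ x, l = com x x)

theorem subst_congr {θ η : Var → Val} {l : Label Acc} (h : ∀ z ∈ l.target, θ z = η z) :
    l.subst θ = l.subst η := by
  cases l <;> simp_all [subst, target]

theorem mem_target_subst {θ : Var → Val} {l l' : Label Acc} (h : l.subst θ = some l') (x : Var) :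
    x ∈ l'.target ↔ ∃ z ∈ l.target, θ z = .var x := by
  cases l <;> simp only [subst, Option.map_eq_some_iff, Option.map₂_eq_some_iff,
    Val.var?_eq_some, Option.mem_def, Option.some.injEq] at h
  case tau => subst h; simp [target]
  case com => obtain ⟨a, b, ha, hb, rfl⟩ := h; simp [target, ha, hb, eq_comm]
  all_goals obtain ⟨a, ha, rfl⟩ := h; simp [target, ha, eq_comm]

theorem subst_defined {θ : Var → Val} {l l' : Label Acc} (h : l.subst θ = some l') {z : Var}
    (hz : z ∈ l.target) : ∃ x, θ z = .var x := by
  cases l <;> simp only [subst, Option.map_eq_some_iff, Option.map₂_eq_some_iff,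
    Val.var?_eq_some, Option.mem_def, Option.some.injEq] at h
  case tau => simp [target] at hz
  case com =>
    obtain ⟨a, b, ha, hb, rfl⟩ := h
    simp only [target, Finset.mem_insert, Finset.mem_singleton] at hz
    rcases hz with rfl | rfl
    exacts [⟨_, ha⟩, ⟨_, hb⟩]
  all_goals
    obtain ⟨a, ha, rfl⟩ := h
    simp only [target, Finset.mem_singleton] at hz
    subst hz
    exact ⟨_, ha⟩

theorem subst_eq_com {θ : Var → Val} {l : Label Acc} {x y : Var} :
    l.subst θ = some (com x y) ↔ ∃ a b, l = com a b ∧ θ a = .var x ∧ θ b = .var y := by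
  cases l <;> simp [subst, Val.var?_eq_some, and_assoc]

theorem subst_eq_tau {θ : Var → Val} {l : Label Acc} : l.subst θ = some tau ↔ l = tau := by
  cases l <;> simp [subst]

theorem subst_var {l : Label Acc} {θ : Var → Val} (h : ∀ z ∈ l.target, θ z = .var z) :
    l.subst θ = some l := by
  cases l <;> simp_all [subst, target, Val.var?]

/-- A boolean produced by the first stage stays a boolean, so the two sides are undefined together.
-/
theorem subst_comp {l : Label Acc} {θ₁ θ₂ θ₃ : Var → Val}
    (h : ∀ z ∈ l.target, θ₃ z = (θ₁ z).subst θ₂) :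
    l.subst θ₃ = (l.subst θ₁).bind fun l' => l'.subst θ₂ := by
  cases l with
  | tau => rfl
  | com x y =>
    simp only [subst, h x (by simp [target]), h y (by simp [target])]
    cases θ₁ x <;> cases θ₁ y <;> simp [Val.var?, Val.subst]
  | inp x | out x | acc x =>
    simp only [subst, h x (by simp [target])]
    cases θ₁ x <;> simp [Val.var?, Val.subst]

theorem target_rename (f : Var → Var) (l : Label Acc) :
    (l.rename f).target = l.target.image f := by
  cases l <;> simp [rename, target, Finset.image_insert]

theorem rename_eq_com {f : Var → Var} {l : Label Acc} {x y : Var} :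
    com x y = l.rename f ↔ ∃ a b, l = com a b ∧ x = f a ∧ y = f b := by
  cases l <;> simp [rename, and_assoc]

theorem rename_congr {f g : Var → Var} {l : Label Acc} (h : ∀ z ∈ l.target, f z = g z) :
    l.rename f = l.rename g := by
  cases l <;> simp_all [rename, target]

theorem rename_injective {f : Var → Var} (hf : Function.Injective f) :
    Function.Injective (rename (Acc := Acc) f) := by
  intro l l' h
  cases l <;> cases l' <;> simp_all [rename, hf.eq_iff]

/-- Closing sends x to 0, which the shift misses; away from x, closing is the shift. Thus a label
that leaves a restriction of x cannot mention x. -/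
theorem rename_close_shift {x : Var} {l l' : Label Acc}
    (h : l.rename (closeMap ![x]) = l'.rename (· + 1)) : l = l' ∧ x ∉ l.target := by
  have hx : x ∉ l.target := by
    intro hx
    have : closeMap ![x] x ∈ (l.rename (closeMap ![x])).target := by
      rw [target_rename]; exact Finset.mem_image_of_mem _ hx
    rw [h, target_rename] at this
    have h0 : closeMap ![x] x = 0 := by simpa using closeMap_apply (singleton_injective x) 0
    simp [h0] at this
  refine ⟨rename_injective (add_left_injective 1) ?_, hx⟩
  rw [← h]
  refine (rename_congr fun z hz => (closeMap_apply' fun i hi => hx ?_)).symm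
  have : x = z := by simpa using hi
  rwa [this]

theorem rename_close {x : Var} {l : Label Acc} (hx : x ∉ l.target) :
    l.rename (closeMap ![x]) = l.rename (· + 1) := by
  refine rename_congr fun z hz => closeMap_apply' fun i hi => hx ?_
  have : x = z := by simpa using hi
  rwa [this]

end Label

/-! ### Finite substitutions as functions. -/

theorem subFun_map {f : Var → Var} (hf : Function.Injective f) (θ : List (Var × Val)) (x : Var) :
    subFun (θ.map fun p => (f p.1, p.2.rename f)) (f x) = (subFun θ x).rename f := by
  unfold subFun
  induction θ with
  | nil => rfl
  | cons p θ ih =>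
    obtain ⟨y, v⟩ := p
    by_cases h : x = y
    · subst h; simp [List.lookup]
    · have h' : f x ≠ f y := fun e => h (hf e)
      replace h := beq_eq_false_iff_ne.mpr h
      replace h' := beq_eq_false_iff_ne.mpr h'
      simp only [List.map_cons, List.lookup, h, h']
      exact ih

theorem Label.subst_rename {f : Var → Var} (hf : Function.Injective f) (θ : List (Var × Val))
    (l : Label Acc) :
    (l.rename f).subst (subFun (θ.map fun p => (f p.1, p.2.rename f))) =
      (l.subst (subFun θ)).map (Label.rename f) := by
  cases l with
  | tau => rfl
  | com x y =>
    simp only [Label.rename, Label.subst, subFun_map hf]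
    cases subFun θ x <;> cases subFun θ y <;> simp [Val.rename, Val.var?, Label.rename]
  | inp x | out x | acc x =>
    simp only [Label.rename, Label.subst, subFun_map hf]
    cases subFun θ x <;> simp [Val.rename, Val.var?, Label.rename]

/-- A lookup returns the first match, so the pairs in front override those of θ. -/
theorem subFun_append_apply {n : ℕ} {ys : Fin n → Var} (hy : Function.Injective ys)
    (vs : Fin n → Val) (θ : List (Var × Val)) (i : Fin n) :
    subFun ((List.ofFn fun i => (ys i, vs i)) ++ θ) (ys i) = vs i := by
  induction n with
  | zero => exact i.elim0
  | succ n ih =>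
    rw [List.ofFn_succ, List.cons_append]
    refine Fin.cases ?_ (fun j => ?_) i
    · simp [subFun, List.lookup]
    · have h : (ys j.succ == ys 0) = false := by simp [hy.eq_iff, Fin.succ_ne_zero]
      have := ih (ys := fun j => ys j.succ) (hy.comp (Fin.succ_injective n)) (fun j => vs j.succ) j
      simp only [subFun, List.lookup, h] at this ⊢
      exact this

theorem subFun_append_apply' {n : ℕ} {ys : Fin n → Var} (vs : Fin n → Val)
    (θ : List (Var × Val)) {z : Var} (hz : ∀ i, ys i ≠ z) :
    subFun ((List.ofFn fun i => (ys i, vs i)) ++ θ) z = subFun θ z := by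
  induction n with
  | zero => simp
  | succ n ih =>
    rw [List.ofFn_succ, List.cons_append]
    have h : (z == ys 0) = false := by simpa using (hz 0).symm
    have := ih (ys := fun j => ys j.succ) (fun j => vs j.succ) fun j => hz j.succ
    simp only [subFun, List.lookup, h] at this ⊢
    exact this

theorem subFun_ofFn_apply {n : ℕ} {ys : Fin n → Var} (hy : Function.Injective ys)
    (vs : Fin n → Val) (i : Fin n) :
    subFun (List.ofFn fun i => (ys i, vs i)) (ys i) = vs i := by
  simpa using subFun_append_apply hy vs [] i

theorem subFun_ofFn_apply' {n : ℕ} {ys : Fin n → Var} (vs : Fin n → Val) {z : Var}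
    (hz : ∀ i, ys i ≠ z) : subFun (List.ofFn fun i => (ys i, vs i)) z = .var z := by
  simpa [subFun] using subFun_append_apply' vs [] hz

/-! ## Renaming and free variables of behavioural types -/

theorem liftRen_injective {n : ℕ} {f : Var → Var} (hf : Function.Injective f) :
    Function.Injective (liftRen n f) := by
  intro a b hab
  unfold liftRen at hab
  split at hab <;> split at hab
  · exact hab
  · rename_i h _
    exact absurd (hab ▸ h) (Nat.not_lt.mpr (Nat.le_add_left n _))
  · rename_i h
    exact absurd (hab.symm ▸ h) (Nat.not_lt.mpr (Nat.le_add_left n _))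
  · rename_i h h'
    have := hf (Nat.add_right_cancel hab)
    rw [← Nat.sub_add_cancel (not_lt.mp h), this, Nat.sub_add_cancel (not_lt.mp h')]

theorem liftRen_comp (n : ℕ) (f g : Var → Var) :
    liftRen n g ∘ liftRen n f = liftRen n (g ∘ f) := by
  funext j
  by_cases h : j < n <;> simp [liftRen, h]

namespace Beh

theorem rename_rename {k : ℕ} (A : Beh Acc k) (f g : Var → Var) :
    (A.rename f).rename g = A.rename (g ∘ f) := by
  induction A generalizing f g with
  | zero | rvar => rfl
  | pre a A ih => cases a <;> simp [rename, ih, Act.rename]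
  | acc x ξ A ih => simp [rename, ih]
  | par A B ihA ihB => simp [rename, ihA, ihB]
  | choice A B ihA ihB => simp [rename, ihA, ihB]
  | rep A ih => simp [rename, ih]
  | sub θ A ih =>
    simp only [rename, ih, List.map_map]
    congr 2
    funext p
    obtain ⟨y, v⟩ := p
    cases v <;> rfl
  | nu A ih => simp [rename, ih, liftRen_comp]
  | mu A ih => simp [rename, ih]
  | excl A S ih => simp [rename, ih, Finset.image_image]
  | proj A S ih => simp [rename, ih, Finset.image_image]

theorem rename_rrename {k m : ℕ} (A : Beh Acc k) (ρ : Fin k → Fin m) (f : Var → Var) :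
    (A.rrename ρ).rename f = (A.rename f).rrename ρ := by
  induction A generalizing m f with
  | zero | rvar => rfl
  | par A B ihA ihB => simp [rename, rrename, ihA, ihB]
  | choice A B ihA ihB => simp [rename, rrename, ihA, ihB]
  | _ => simp [rename, rrename, *]

theorem rename_rsubst {k m : ℕ} (A : Beh Acc k) (σ : Fin k → Beh Acc m) (f : Var → Var) :
    (A.rsubst σ).rename f = (A.rename f).rsubst fun i => (σ i).rename f := by
  induction A generalizing m f with
  | zero | rvar => rfl
  | par A B ihA ihB => simp [rename, rsubst, ihA, ihB]
  | choice A B ihA ihB => simp [rename, rsubst, ihA, ihB]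
  | nu A ih =>
    simp only [rename, rsubst, ih, rename_rename]
    rfl
  | mu A ih =>
    simp only [rename, rsubst, ih]
    congr 2
    funext i
    refine Fin.cases rfl (fun j => ?_) i
    simp [rename_rrename]
  | _ => simp [rename, rsubst, *]

theorem rename_unfold (A : Beh Acc 1) (f : Var → Var) :
    A.unfold.rename f = (A.rename f).unfold :=
  rename_rsubst _ _ _

theorem fv_rename_subset {k : ℕ} (A : Beh Acc k) {f : Var → Var} (hf : Function.Injective f) :
    (A.rename f).fv ⊆ A.fv.image f := by
  induction A generalizing f with
  | zero | rvar => simp [rename, fv]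
  | pre a A ih =>
    simp only [rename, fv, Finset.image_union]
    exact Finset.union_subset_union (by cases a <;> simp [Act.rename, Act.fv]) (ih hf)
  | acc x ξ A ih =>
    simp only [rename, fv, Finset.image_insert]
    exact Finset.insert_subset_insert _ (ih hf)
  | par A B ihA ihB =>
    simp only [rename, fv, Finset.image_union]
    exact Finset.union_subset_union (ihA hf) (ihB hf)
  | choice A B ihA ihB =>
    simp only [rename, fv, Finset.image_union]
    exact Finset.union_subset_union (ihA hf) (ihB hf)
  | rep A ih => exact ih hf
  | sub θ A ih =>
    simp only [rename, fv, Finset.image_union]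
    refine Finset.union_subset_union (fun x hx => ?_) (fun x hx => ?_)
    · obtain ⟨hx, hx'⟩ := Finset.mem_sdiff.mp hx
      obtain ⟨y, hy, rfl⟩ := Finset.mem_image.mp (ih hf hx)
      refine Finset.mem_image_of_mem _ (Finset.mem_sdiff.mpr ⟨hy, fun h => hx' ?_⟩)
      simp only [subDom, List.mem_toFinset, List.mem_map] at h ⊢
      obtain ⟨p, hp, rfl⟩ := h
      exact ⟨_, ⟨p, hp, rfl⟩, rfl⟩
    · simp only [subRange, List.mem_toFinset, List.mem_filterMap, List.mem_map,
        Val.var?_eq_some] at hx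
      obtain ⟨_, ⟨⟨y, v⟩, hp, rfl⟩, hv⟩ := hx
      cases v with
      | bool b => simp [Val.rename] at hv
      | var z =>
        simp only [Val.rename, Val.var.injEq] at hv
        subst hv
        refine Finset.mem_image_of_mem _ ?_
        simp only [subRange, List.mem_toFinset, List.mem_filterMap, Val.var?_eq_some]
        exact ⟨_, hp, rfl⟩
  | nu A ih =>
    simp only [rename, fv]
    intro x hx
    obtain ⟨y, hy, rfl⟩ := Finset.mem_image.mp hx
    obtain ⟨hy0, hy⟩ := Finset.mem_erase.mp hy
    obtain ⟨z, hz, rfl⟩ := Finset.mem_image.mp (ih (liftRen_injective hf) hy)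
    have hz0 : z ≠ 0 := by rintro rfl; simp [liftRen] at hy0
    refine Finset.mem_image.mpr ⟨z - 1, Finset.mem_image_of_mem _
      (Finset.mem_erase.mpr ⟨hz0, hz⟩), ?_⟩
    simp [liftRen, hz0]
  | mu A ih => exact ih hf
  | excl A S ih =>
    intro x hx
    obtain ⟨hx, hx'⟩ := Finset.mem_sdiff.mp hx
    obtain ⟨y, hy, rfl⟩ := Finset.mem_image.mp (ih hf hx)
    exact Finset.mem_image_of_mem _
      (Finset.mem_sdiff.mpr ⟨hy, fun h => hx' (Finset.mem_image_of_mem _ h)⟩)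
  | proj A S ih =>
    intro x hx
    obtain ⟨hx, hx'⟩ := Finset.mem_inter.mp hx
    obtain ⟨y, hy, rfl⟩ := Finset.mem_image.mp (ih hf hx)
    obtain ⟨z, hz, hzy⟩ := Finset.mem_image.mp hx'
    rw [hf hzy] at hz
    exact Finset.mem_image_of_mem _ (Finset.mem_inter.mpr ⟨hy, hz⟩)

theorem fv_rrename {k m : ℕ} (A : Beh Acc k) (ρ : Fin k → Fin m) : (A.rrename ρ).fv = A.fv := by
  induction A generalizing m with
  | zero | rvar => rfl
  | par A B ihA ihB => simp [rrename, fv, ihA, ihB]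
  | choice A B ihA ihB => simp [rrename, fv, ihA, ihB]
  | _ => simp [rrename, fv, *]

theorem fv_rsubst_subset {k m : ℕ} (A : Beh Acc k) (σ : Fin k → Beh Acc m) {S : Finset Var}
    (hS : ∀ i, (σ i).fv ⊆ S) : (A.rsubst σ).fv ⊆ A.fv ∪ S := by
  induction A generalizing m S with
  | zero => simp [rsubst, fv]
  | rvar i => exact (hS i).trans Finset.subset_union_right
  | pre a A ih =>
    simp only [rsubst, fv, Finset.union_assoc]
    exact Finset.union_subset_union_right (ih σ hS)
  | acc x ξ A ih =>
    simp only [rsubst, fv, Finset.insert_union]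
    exact Finset.insert_subset_insert _ (ih σ hS)
  | par A B ihA ihB =>
    refine Finset.union_subset ((ihA σ hS).trans ?_) ((ihB σ hS).trans ?_) <;> intro x <;>
      simp only [fv, Finset.mem_union] <;> tauto
  | choice A B ihA ihB =>
    refine Finset.union_subset ((ihA σ hS).trans ?_) ((ihB σ hS).trans ?_) <;> intro x <;>
      simp only [fv, Finset.mem_union] <;> tauto
  | rep A ih => exact ih σ hS
  | sub θ A ih =>
    intro x hx
    have := @ih m σ S hS x
    simp only [rsubst, fv, Finset.mem_union, Finset.mem_sdiff] at *
    tauto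
  | nu A ih =>
    intro x hx
    simp only [rsubst, fv, Finset.mem_image, Finset.mem_erase] at hx
    obtain ⟨y, ⟨hy0, hy⟩, rfl⟩ := hx
    -- The types put below ν are shifted, so the bound on their variables is shifted as well;
    -- leaving the binder undoes this.
    have := ih (fun i => (σ i).rename (· + 1)) (S := S.image (· + 1))
      (fun i => (fv_rename_subset _ (add_left_injective 1)).trans (Finset.image_subset_image (hS i)))
      hy
    simp only [fv, Finset.mem_union, Finset.mem_image, Finset.mem_erase] at this ⊢
    rcases this with h | ⟨z, hz, rfl⟩
    · exact .inl ⟨y, ⟨hy0, h⟩, rfl⟩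
    · exact .inr hz
  | mu A ih =>
    refine ih _ fun i => ?_
    refine Fin.cases (by simp [fv]) (fun j => ?_) i
    simpa [fv_rrename] using hS j
  | excl A S' ih =>
    intro x hx
    have := @ih m σ S hS x
    simp only [rsubst, fv, Finset.mem_union, Finset.mem_sdiff] at *
    tauto
  | proj A S' ih =>
    intro x hx
    have := @ih m σ S hS x
    simp only [rsubst, fv, Finset.mem_union, Finset.mem_inter] at *
    tauto

theorem fv_unfold_subset (A : Beh Acc 1) : A.unfold.fv ⊆ A.fv :=
  (fv_rsubst_subset A (fun _ => A.mu) (S := A.fv) fun _ => subset_rfl).trans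
    (Finset.union_self _).subset

end Beh

theorem subFun_eq_var {θ : List (Var × Val)} {x z : Var} (h : subFun θ z = .var x) :
    (x = z ∧ z ∉ subDom θ) ∨ x ∈ subRange θ := by
  unfold subFun at h
  cases hl : θ.lookup z with
  | none =>
    rw [hl] at h
    simp only [Option.getD_none, Val.var.injEq] at h
    refine .inl ⟨h.symm, fun hz => ?_⟩
    simp only [List.lookup_eq_none_iff, subDom, List.mem_toFinset, List.mem_map] at hl hz
    obtain ⟨p, hp, rfl⟩ := hz
    simpa using hl p hp
  | some v =>
    rw [hl] at h
    simp only [Option.getD_some] at h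
    subst h
    right
    simp only [subRange, List.mem_toFinset, List.mem_filterMap, Val.var?_eq_some]
    obtain ⟨l₁, l₂, rfl, _⟩ := List.lookup_eq_some_iff.mp hl
    exact ⟨(z, .var x), by simp, rfl⟩

/-- Transitions only involve free variables, and create none. -/
theorem Step.fv_subset {A A' : Beh Acc 0} {l : Label Acc} (h : Step A l A') :
    l.target ⊆ A.fv ∧ A'.fv ⊆ A.fv := by
  induction h with
  | act a A =>
    refine ⟨?_, Finset.subset_union_right⟩
    cases a <;> simp [Label.ofAct, Label.target, Beh.fv, Act.fv]
  | acc x ξ A => exact ⟨by simp [Label.target, Beh.fv], Finset.subset_insert _ _⟩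
  | parL B h ih =>
    exact ⟨ih.1.trans Finset.subset_union_left, Finset.union_subset_union_left ih.2⟩
  | parR A h ih =>
    exact ⟨ih.1.trans Finset.subset_union_right, Finset.union_subset_union_right ih.2⟩
  | comL h h' ih ih' | comR h h' ih ih' =>
    refine ⟨?_, Finset.union_subset_union ih.2 ih'.2⟩
    have h1 := ih.1
    have h2 := ih'.1
    simp only [Label.target, Finset.singleton_subset_iff] at h1 h2
    simp [Label.target, Beh.fv, Finset.insert_subset_iff, h1, h2]
  | tau h ih => exact ⟨by simp [Label.target], ih.2⟩
  | choiceL B h ih =>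
    exact ⟨ih.1.trans Finset.subset_union_left, ih.2.trans Finset.subset_union_left⟩
  | choiceR A h ih =>
    exact ⟨ih.1.trans Finset.subset_union_right, ih.2.trans Finset.subset_union_right⟩
  | rep h ih => simpa [Beh.fv] using ih
  | @mu A _ _ h ih => exact ⟨ih.1.trans A.fv_unfold_subset, ih.2.trans A.fv_unfold_subset⟩
  | @sub θ A l l' A' h hl ih =>
    refine ⟨fun x hx => ?_, Finset.union_subset_union_left (Finset.sdiff_subset_sdiff ih.2 subset_rfl)⟩
    obtain ⟨z, hz, hzx⟩ := (Label.mem_target_subst hl x).mp hx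
    rcases subFun_eq_var hzx with ⟨rfl, h⟩ | h
    · exact Finset.mem_union_left _ (Finset.mem_sdiff.mpr ⟨ih.1 hz, h⟩)
    · exact Finset.mem_union_right _ h
  | new h ih =>
    rw [Label.target_rename] at ih
    refine ⟨fun x hx => ?_, Finset.image_subset_image (Finset.erase_subset_erase _ ih.2)⟩
    exact Finset.mem_image.mpr ⟨x + 1, Finset.mem_erase.mpr
      ⟨Nat.succ_ne_zero x, ih.1 (Finset.mem_image_of_mem _ hx)⟩, rfl⟩
  | exclIn h hS ih =>
    exact ⟨by simp [Label.target], Finset.sdiff_subset_sdiff ih.2 subset_rfl⟩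
  | exclOut h hS ih =>
    exact ⟨Finset.subset_sdiff.mpr ⟨ih.1, hS⟩, Finset.sdiff_subset_sdiff ih.2 subset_rfl⟩
  | projIn h hS ih =>
    exact ⟨Finset.subset_inter ih.1 hS, Finset.inter_subset_inter_right ih.2⟩
  | projOut h hS ih =>
    exact ⟨by simp [Label.target], Finset.inter_subset_inter_right ih.2⟩

/-! ## Inversion of transitions -/

theorem Step.contract {A B : Beh Acc 0} {l l' : Label Acc} (h : Step A l B)
    (hl : l.Contracts l') : Step A l' B := by
  rcases hl with rfl | ⟨rfl, x, rfl⟩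
  exacts [h, h.tau]

theorem Step.zero_inv {l : Label Acc} {X : Beh Acc 0} (h : Step .zero l X) : False := by
  generalize hZ : Beh.zero = Z at h
  induction h <;> simp_all

theorem Step.pre_inv {a : Act} {A X : Beh Acc 0} {l : Label Acc} (h : Step (.pre a A) l X) :
    l = .ofAct a ∧ X = A := by
  generalize hZ : Beh.pre a A = Z at h
  induction h <;> simp_all
  cases a <;> simp_all [Label.ofAct]

theorem Step.acc_inv {x : Var} {ξ : Acc} {A X : Beh Acc 0} {l : Label Acc}
    (h : Step (.acc x ξ A) l X) : l = .acc x ξ ∧ X = A := by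
  generalize hZ : Beh.acc x ξ A = Z at h
  induction h <;> simp_all

/-- The rule turning {x, x̄} into τ applies to every type, so inversion must allow for it. Inside
one component the contraction is a transition of that component; only for a communication between
the two does `Contracts` remain. -/
theorem Step.par_inv {A B X : Beh Acc 0} {l : Label Acc} (h : Step (.par A B) l X) :
    (∃ A', X = .par A' B ∧ Step A l A') ∨ (∃ B', X = .par A B' ∧ Step B l B') ∨
      ∃ A' B' x y, X = .par A' B' ∧ ((Step A (.inp x) A' ∧ Step B (.out y) B') ∨
        (Step A (.out y) A' ∧ Step B (.inp x) B')) ∧ (Label.com x y).Contracts l := by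
  generalize hZ : Beh.par A B = Z at h
  induction h with
  | parL B h => cases hZ; exact .inl ⟨_, rfl, h⟩
  | parR A h => cases hZ; exact .inr (.inl ⟨_, rfl, h⟩)
  | comL h h' => cases hZ; exact .inr (.inr ⟨_, _, _, _, rfl, .inl ⟨h, h'⟩, .inl rfl⟩)
  | comR h h' => cases hZ; exact .inr (.inr ⟨_, _, _, _, rfl, .inr ⟨h, h'⟩, .inl rfl⟩)
  | tau h ih =>
    rcases ih hZ with ⟨A', rfl, hs⟩ | ⟨B', rfl, hs⟩ | ⟨A', B', x, y, rfl, h, hl⟩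
    · exact .inl ⟨_, rfl, hs.tau⟩
    · exact .inr (.inl ⟨_, rfl, hs.tau⟩)
    · rcases hl with hl | ⟨hl, _⟩
      · cases hl
        exact .inr (.inr ⟨_, _, _, _, rfl, h, .inr ⟨rfl, _, rfl⟩⟩)
      · cases hl
  | _ => cases hZ

/-- The substitution may identify two channels, so a τ can arise from a communication {a, b̄} of A
with a ≠ b. Hence the contraction comes after the substitution and cannot be moved below it. -/
theorem Step.sub_inv {θ : List (Var × Val)} {A X : Beh Acc 0} {l : Label Acc}
    (h : Step (.sub θ A) l X) : ∃ A' l₀ l₁, X = .sub θ A' ∧ Step A l₀ A' ∧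
      l₀.subst (subFun θ) = some l₁ ∧ l₁.Contracts l := by
  generalize hZ : Beh.sub θ A = Z at h
  induction h with
  | sub h hl => cases hZ; exact ⟨_, _, _, rfl, h, hl, .inl rfl⟩
  | tau h ih =>
    obtain ⟨A', l₀, l₁, rfl, h, hl, hl'⟩ := ih hZ
    rcases hl' with rfl | ⟨hl', _⟩
    · exact ⟨_, _, _, rfl, h, hl, .inr ⟨rfl, _, rfl⟩⟩
    · cases hl'
  | _ => cases hZ

/-- Unlike for a substitution, a contraction can here be performed below the constructor, as {x, x̄}
is a communication on one channel there too. The same holds for exclusion and projection. -/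
theorem Step.nu_inv {A X : Beh Acc 0} {l : Label Acc} (h : Step (.nu A) l X) :
    ∃ A', X = .nu A' ∧ Step A (l.rename (· + 1)) A' := by
  generalize hZ : Beh.nu A = Z at h
  induction h with
  | new h => cases hZ; exact ⟨_, rfl, h⟩
  | tau h ih =>
    obtain ⟨A', rfl, hs⟩ := ih hZ
    exact ⟨A', rfl, hs.tau⟩
  | _ => cases hZ

theorem Step.excl_inv {A X : Beh Acc 0} {S : Finset Var} {l : Label Acc}
    (h : Step (.excl A S) l X) : ∃ A', X = .excl A' S ∧
      ((∃ l₀, Step A l₀ A' ∧ l₀.target ⊆ S ∧ l = .tau) ∨ (Step A l A' ∧ Disjoint l.target S)) := by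
  generalize hZ : Beh.excl A S = Z at h
  induction h with
  | exclIn h hS => cases hZ; exact ⟨_, rfl, .inl ⟨_, h, hS, rfl⟩⟩
  | exclOut h hS => cases hZ; exact ⟨_, rfl, .inr ⟨h, hS⟩⟩
  | tau h ih =>
    obtain ⟨A', rfl, ⟨_, _, _, hs⟩ | ⟨hs, _⟩⟩ := ih hZ
    · cases hs
    · exact ⟨_, rfl, .inr ⟨hs.tau, by simp [Label.target]⟩⟩
  | _ => cases hZ

theorem Step.proj_inv {A X : Beh Acc 0} {S : Finset Var} {l : Label Acc}
    (h : Step (.proj A S) l X) : ∃ A', X = .proj A' S ∧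
      ((∃ l₀, Step A l₀ A' ∧ Disjoint l₀.target S ∧ l = .tau) ∨
        (Step A l A' ∧ l.target ⊆ S)) := by
  generalize hZ : Beh.proj A S = Z at h
  induction h with
  | projOut h hS => cases hZ; exact ⟨_, rfl, .inl ⟨_, h, hS, rfl⟩⟩
  | projIn h hS => cases hZ; exact ⟨_, rfl, .inr ⟨h, hS⟩⟩
  | tau h ih =>
    obtain ⟨A', rfl, ⟨_, _, _, hs⟩ | ⟨hs, _⟩⟩ := ih hZ
    · cases hs
    · exact ⟨_, rfl, .inr ⟨hs.tau, by simp [Label.target]⟩⟩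
  | _ => cases hZ

/-- A communication label can be split into an input and an output, in either order. -/
theorem Step.com_split {A A' : Beh Acc 0} {x y : Var} (h : Step A (.com x y) A') :
    (∃ B, Step A (.inp x) B ∧ Step B (.out y) A') ∧
      ∃ B, Step A (.out y) B ∧ Step B (.inp x) A' := by
  generalize hl : Label.com x y = l at h
  induction h generalizing x y with
  | act a A => cases a <;> cases hl
  | acc => cases hl
  | tau => cases hl
  | exclIn => cases hl
  | projOut => cases hl
  | parL B h ih =>
    obtain ⟨⟨C, h1, h2⟩, D, h3, h4⟩ := ih hl
    exact ⟨⟨_, h1.parL B, h2.parL B⟩, _, h3.parL B, h4.parL B⟩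
  | parR B h ih =>
    obtain ⟨⟨C, h1, h2⟩, D, h3, h4⟩ := ih hl
    exact ⟨⟨_, h1.parR B, h2.parR B⟩, _, h3.parR B, h4.parR B⟩
  | comL h h' =>
    cases hl
    -- The two components act independently, so either may go first.
    exact ⟨⟨_, h.parL _, h'.parR _⟩, _, h'.parR _, h.parL _⟩
  | comR h h' =>
    cases hl
    exact ⟨⟨_, h'.parR _, h.parL _⟩, _, h.parL _, h'.parR _⟩
  | choiceL B h ih =>
    obtain ⟨⟨C, h1, h2⟩, D, h3, h4⟩ := ih hl
    -- The first half resolves the choice; the second starts from the chosen residual.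
    exact ⟨⟨_, h1.choiceL B, h2⟩, _, h3.choiceL B, h4⟩
  | choiceR B h ih =>
    obtain ⟨⟨C, h1, h2⟩, D, h3, h4⟩ := ih hl
    exact ⟨⟨_, h1.choiceR B, h2⟩, _, h3.choiceR B, h4⟩
  | rep h ih =>
    obtain ⟨⟨C, h1, h2⟩, D, h3, h4⟩ := ih hl
    exact ⟨⟨_, h1.rep, h2⟩, _, h3.rep, h4⟩
  | mu h ih =>
    obtain ⟨⟨C, h1, h2⟩, D, h3, h4⟩ := ih hl
    exact ⟨⟨_, h1.mu, h2⟩, _, h3.mu, h4⟩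
  | @sub θ _ _ _ _ h hs ih =>
    subst hl
    obtain ⟨a, b, rfl, ha, hb⟩ := Label.subst_eq_com.mp hs
    obtain ⟨⟨C, h1, h2⟩, D, h3, h4⟩ := ih rfl
    have hi : (Label.inp a : Label Acc).subst (subFun θ) = some (.inp x) := by
      simp [Label.subst, ha, Val.var?]
    have ho : (Label.out b : Label Acc).subst (subFun θ) = some (.out y) := by
      simp [Label.subst, hb, Val.var?]
    exact ⟨⟨_, h1.sub hi, h2.sub ho⟩, _, h3.sub ho, h4.sub hi⟩
  | new h ih =>
    subst hl
    obtain ⟨⟨C, h1, h2⟩, D, h3, h4⟩ := ih rfl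
    exact ⟨⟨_, .new h1, .new h2⟩, _, .new h3, .new h4⟩
  | exclOut h hS ih =>
    subst hl
    obtain ⟨⟨C, h1, h2⟩, D, h3, h4⟩ := ih rfl
    -- Each half involves only variables of the communication, so it inherits the side condition on
    -- S.
    simp only [Label.target, Finset.disjoint_insert_left, Finset.disjoint_singleton_left] at hS
    have hi : Disjoint (Label.inp x : Label Acc).target _ := Finset.disjoint_singleton_left.mpr hS.1
    have ho : Disjoint (Label.out y : Label Acc).target _ := Finset.disjoint_singleton_left.mpr hS.2
    exact ⟨⟨_, h1.exclOut hi, h2.exclOut ho⟩, _, h3.exclOut ho, h4.exclOut hi⟩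
  | projIn h hS ih =>
    subst hl
    obtain ⟨⟨C, h1, h2⟩, D, h3, h4⟩ := ih rfl
    simp only [Label.target, Finset.insert_subset_iff, Finset.singleton_subset_iff] at hS
    have hi : (Label.inp x : Label Acc).target ⊆ _ := Finset.singleton_subset_iff.mpr hS.1
    have ho : (Label.out y : Label Acc).target ⊆ _ := Finset.singleton_subset_iff.mpr hS.2
    exact ⟨⟨_, h1.projIn hi, h2.projIn ho⟩, _, h3.projIn ho, h4.projIn hi⟩

/-! ### Transitions under injective renaming. -/

theorem Step.rename {A B : Beh Acc 0} {l : Label Acc} (h : Step A l B) {f : Var → Var}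
    (hf : Function.Injective f) : Step (A.rename f) (l.rename f) (B.rename f) := by
  induction h generalizing f with
  | act a A => cases a <;> exact .act _ _
  | acc x ξ A => exact .acc _ _ _
  | parL B h ih => exact .parL _ (ih hf)
  | parR B h ih => exact .parR _ (ih hf)
  | comL h h' ih ih' => exact .comL (ih hf) (ih' hf)
  | comR h h' ih ih' => exact .comR (ih hf) (ih' hf)
  | tau h ih => exact (ih hf).tau
  | choiceL B h ih => exact .choiceL _ (ih hf)
  | choiceR B h ih => exact .choiceR _ (ih hf)
  | rep h ih => exact .rep (ih hf)
  | mu h ih => exact .mu (by rw [← Beh.rename_unfold]; exact ih hf)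
  | sub h hl ih =>
    exact .sub (ih hf) (by rw [Label.subst_rename hf, hl]; rfl)
  | @new A l A' h ih =>
    refine .new ?_
    have := ih (liftRen_injective (n := 1) hf)
    convert this using 1
    cases l <;> rfl
  | exclIn h hS ih =>
    exact .exclIn (ih hf) (by rw [Label.target_rename]; exact Finset.image_subset_image hS)
  | exclOut h hS ih =>
    exact .exclOut (ih hf) (by rw [Label.target_rename]; exact (Finset.disjoint_image hf).mpr hS)
  | projIn h hS ih =>
    exact .projIn (ih hf) (by rw [Label.target_rename]; exact Finset.image_subset_image hS)
  | projOut h hS ih =>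
    exact .projOut (ih hf) (by rw [Label.target_rename]; exact (Finset.disjoint_image hf).mpr hS)

theorem Label.rename_lift_shift {f : Var → Var} {l l' : Label Acc}
    (h : l'.rename (· + 1) = l.rename (liftRen 1 f)) :
    ∃ l₀ : Label Acc, l = l₀.rename (· + 1) ∧ l' = l₀.rename f := by
  have key : ∀ {a b : Var}, a + 1 = liftRen 1 f b → ∃ c, b = c + 1 ∧ a = f c := by
    intro a b hab
    cases b with
    | zero => simp [liftRen] at hab
    | succ c => exact ⟨c, rfl, by simpa [liftRen] using hab⟩
  cases l' <;> cases l <;> simp only [Label.rename, reduceCtorEq, Label.inp.injEq,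
    Label.out.injEq, Label.acc.injEq, Label.com.injEq] at h
  · obtain ⟨c, rfl, rfl⟩ := key h; exact ⟨.inp c, rfl, rfl⟩
  · obtain ⟨c, rfl, rfl⟩ := key h; exact ⟨.out c, rfl, rfl⟩
  · exact ⟨.tau, rfl, rfl⟩
  · obtain ⟨h, rfl⟩ := h; obtain ⟨c, rfl, rfl⟩ := key h; exact ⟨.acc c _, rfl, rfl⟩
  · obtain ⟨h, h'⟩ := h
    obtain ⟨c, rfl, rfl⟩ := key h
    obtain ⟨d, rfl, rfl⟩ := key h'
    exact ⟨.com c d, rfl, rfl⟩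

/-- Typing names the variable that ν binds while transitions see index 0, so moves below ν are read
back through the injective `closeMap`. -/
theorem Step.rename_inv {A X : Beh Acc 0} {l : Label Acc} {f : Var → Var}
    (hf : Function.Injective f) (h : Step (A.rename f) l X) :
    ∃ l₀ A', l = l₀.rename f ∧ X = A'.rename f ∧ Step A l₀ A' := by
  generalize hZ : A.rename f = Z at h
  induction h generalizing A f with
  | act a B =>
    cases A <;> simp only [Beh.rename, reduceCtorEq, Beh.pre.injEq] at hZ
    obtain ⟨rfl, rfl⟩ := hZ
    rename_i a A
    exact ⟨.ofAct a, A, by cases a <;> rfl, rfl, .act _ _⟩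
  | acc x ξ B =>
    cases A <;> simp only [Beh.rename, reduceCtorEq, Beh.acc.injEq] at hZ
    obtain ⟨rfl, rfl, rfl⟩ := hZ
    exact ⟨_, _, rfl, rfl, .acc _ _ _⟩
  | parL B h ih =>
    cases A <;> simp only [Beh.rename, reduceCtorEq, Beh.par.injEq] at hZ
    obtain ⟨rfl, rfl⟩ := hZ
    obtain ⟨l₀, A', rfl, rfl, hs⟩ := ih hf rfl
    exact ⟨_, .par A' _, rfl, rfl, .parL _ hs⟩
  | parR B h ih =>
    cases A <;> simp only [Beh.rename, reduceCtorEq, Beh.par.injEq] at hZ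
    obtain ⟨rfl, rfl⟩ := hZ
    obtain ⟨l₀, A', rfl, rfl, hs⟩ := ih hf rfl
    exact ⟨_, .par _ A', rfl, rfl, .parR _ hs⟩
  | comL h h' ih ih' =>
    cases A <;> simp only [Beh.rename, reduceCtorEq, Beh.par.injEq] at hZ
    obtain ⟨rfl, rfl⟩ := hZ
    obtain ⟨l₀, A', hl, rfl, hs⟩ := ih hf rfl
    obtain ⟨l₁, B', hl', rfl, hs'⟩ := ih' hf rfl
    cases l₀ <;> simp only [Label.rename, reduceCtorEq, Label.inp.injEq] at hl
    cases l₁ <;> simp only [Label.rename, reduceCtorEq, Label.out.injEq] at hl'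
    subst hl hl'
    exact ⟨.com _ _, .par A' B', rfl, rfl, .comL hs hs'⟩
  | comR h h' ih ih' =>
    cases A <;> simp only [Beh.rename, reduceCtorEq, Beh.par.injEq] at hZ
    obtain ⟨rfl, rfl⟩ := hZ
    obtain ⟨l₀, A', hl, rfl, hs⟩ := ih hf rfl
    obtain ⟨l₁, B', hl', rfl, hs'⟩ := ih' hf rfl
    cases l₀ <;> simp only [Label.rename, reduceCtorEq, Label.out.injEq] at hl
    cases l₁ <;> simp only [Label.rename, reduceCtorEq, Label.inp.injEq] at hl'
    subst hl hl'
    exact ⟨.com _ _, .par A' B', rfl, rfl, .comR hs hs'⟩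
  | tau h ih =>
    obtain ⟨l₀, A', hl, rfl, hs⟩ := ih hf hZ
    obtain ⟨a, b, rfl, rfl, hab⟩ := Label.rename_eq_com.mp hl
    -- By injectivity a communication on one channel was already one before the renaming.
    rw [hf hab] at hs
    exact ⟨.tau, A', rfl, rfl, hs.tau⟩
  | choiceL B h ih =>
    cases A <;> simp only [Beh.rename, reduceCtorEq, Beh.choice.injEq] at hZ
    obtain ⟨rfl, rfl⟩ := hZ
    obtain ⟨l₀, A', rfl, rfl, hs⟩ := ih hf rfl
    exact ⟨_, A', rfl, rfl, .choiceL _ hs⟩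
  | choiceR B h ih =>
    cases A <;> simp only [Beh.rename, reduceCtorEq, Beh.choice.injEq] at hZ
    obtain ⟨rfl, rfl⟩ := hZ
    obtain ⟨l₀, A', rfl, rfl, hs⟩ := ih hf rfl
    exact ⟨_, A', rfl, rfl, .choiceR _ hs⟩
  | rep h ih =>
    cases A <;> simp only [Beh.rename, reduceCtorEq, Beh.rep.injEq] at hZ
    subst hZ
    rename_i A
    obtain ⟨l₀, A', rfl, rfl, hs⟩ := ih (A := .par A (.rep A)) hf rfl
    exact ⟨_, A', rfl, rfl, .rep hs⟩
  | mu h ih =>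
    cases A <;> simp only [Beh.rename, reduceCtorEq, Beh.mu.injEq] at hZ
    subst hZ
    obtain ⟨l₀, A', rfl, rfl, hs⟩ := ih hf (Beh.rename_unfold _ _)
    exact ⟨_, A', rfl, rfl, .mu hs⟩
  | sub h hl ih =>
    cases A <;> simp only [Beh.rename, reduceCtorEq, Beh.sub.injEq] at hZ
    obtain ⟨rfl, rfl⟩ := hZ
    obtain ⟨l₀, A', rfl, rfl, hs⟩ := ih hf rfl
    rw [Label.subst_rename hf, Option.map_eq_some_iff] at hl
    obtain ⟨l₁, hl, rfl⟩ := hl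
    exact ⟨_, .sub _ A', rfl, rfl, .sub hs hl⟩
  | new h ih =>
    cases A <;> simp only [Beh.rename, reduceCtorEq, Beh.nu.injEq] at hZ
    subst hZ
    obtain ⟨l₀, A', hl, rfl, hs⟩ := ih (liftRen_injective (n := 1) hf) rfl
    obtain ⟨l₁, rfl, rfl⟩ := Label.rename_lift_shift hl
    exact ⟨_, .nu A', rfl, rfl, .new hs⟩
  | exclIn h hS ih =>
    cases A <;> simp only [Beh.rename, reduceCtorEq, Beh.excl.injEq] at hZ
    obtain ⟨rfl, rfl⟩ := hZ
    obtain ⟨l₀, A', rfl, rfl, hs⟩ := ih hf rfl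
    rw [Label.target_rename, Finset.image_subset_image_iff hf] at hS
    exact ⟨.tau, .excl A' _, rfl, rfl, .exclIn hs hS⟩
  | exclOut h hS ih =>
    cases A <;> simp only [Beh.rename, reduceCtorEq, Beh.excl.injEq] at hZ
    obtain ⟨rfl, rfl⟩ := hZ
    obtain ⟨l₀, A', rfl, rfl, hs⟩ := ih hf rfl
    rw [Label.target_rename, Finset.disjoint_image hf] at hS
    exact ⟨_, .excl A' _, rfl, rfl, .exclOut hs hS⟩
  | projIn h hS ih =>
    cases A <;> simp only [Beh.rename, reduceCtorEq, Beh.proj.injEq] at hZ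
    obtain ⟨rfl, rfl⟩ := hZ
    obtain ⟨l₀, A', rfl, rfl, hs⟩ := ih hf rfl
    rw [Label.target_rename, Finset.image_subset_image_iff hf] at hS
    exact ⟨_, .proj A' _, rfl, rfl, .projIn hs hS⟩
  | projOut h hS ih =>
    cases A <;> simp only [Beh.rename, reduceCtorEq, Beh.proj.injEq] at hZ
    obtain ⟨rfl, rfl⟩ := hZ
    obtain ⟨l₀, A', rfl, rfl, hs⟩ := ih hf rfl
    rw [Label.target_rename, Finset.disjoint_image hf] at hS
    exact ⟨.tau, .proj A' _, rfl, rfl, .projOut hs hS⟩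

/-! ## Weak transitions -/

theorem TauSteps.map {F : Beh Acc 0 → Beh Acc 0}
    (hF : ∀ A B, Step A .tau B → Step (F A) .tau (F B)) {A B : Beh Acc 0} (h : TauSteps A B) :
    TauSteps (F A) (F B) :=
  Relation.ReflTransGen.lift F hF _ _ h

namespace WStep

theorem refl (A : Beh Acc 0) : WStep A .tau A :=
  .inl ⟨rfl, .refl⟩

theorem of_step {A B : Beh Acc 0} {l : Label Acc} (h : Step A l B) : WStep A l B := by
  by_cases hl : l = .tau
  · subst hl; exact .inl ⟨rfl, .single h⟩
  · exact .inr ⟨hl, _, _, .refl, h, .refl⟩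

theorem head {A B C : Beh Acc 0} {l : Label Acc} (h : TauSteps A B) (h' : WStep B l C) :
    WStep A l C := by
  rcases h' with ⟨rfl, h'⟩ | ⟨hl, D, E, h1, h2, h3⟩
  · exact .inl ⟨rfl, h.trans h'⟩
  · exact .inr ⟨hl, D, E, h.trans h1, h2, h3⟩

theorem tail {A B C : Beh Acc 0} {l : Label Acc} (h : WStep A l B) (h' : TauSteps B C) :
    WStep A l C := by
  rcases h with ⟨rfl, h⟩ | ⟨hl, D, E, h1, h2, h3⟩
  · exact .inl ⟨rfl, h.trans h'⟩
  · exact .inr ⟨hl, D, E, h1, h2, h3.trans h'⟩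

theorem tauSteps {A B : Beh Acc 0} (h : WStep A .tau B) : TauSteps A B := by
  rcases h with ⟨_, h⟩ | ⟨h, _⟩
  exacts [h, absurd rfl h]

/-- The condition that τ goes to τ is needed because a weak τ may be empty, and no step can answer
any other label in that case. -/
theorem map {F : Beh Acc 0 → Beh Acc 0} {l l' : Label Acc}
    (hF : ∀ A B, Step A .tau B → Step (F A) .tau (F B))
    (hl : ∀ A B, Step A l B → Step (F A) l' (F B)) (hl' : l = .tau → l' = .tau)
    {A B : Beh Acc 0} (h : WStep A l B) : WStep (F A) l' (F B) := by
  rcases h with ⟨h, h1⟩ | ⟨_, D, E, h1, h2, h3⟩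
  · rw [hl' h]; exact .inl ⟨rfl, h1.map hF⟩
  · exact ((of_step (hl _ _ h2)).head (h1.map hF)).tail (h3.map hF)

theorem contract {A B : Beh Acc 0} {l l' : Label Acc} (h : WStep A l B) (hl : l.Contracts l') :
    WStep A l' B := by
  rcases hl with rfl | ⟨rfl, x, rfl⟩
  · exact h
  · exact map (F := id) (fun _ _ h => h) (fun _ _ h => h.tau) (fun _ => rfl) h

/-- Labels other than τ guarantee that both sides really move; the silent steps before and after the
synchronisation are interleaved freely. -/
theorem com {A A' B B' : Beh Acc 0} {l l' l'' : Label Acc} (h : WStep A l A')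
    (h' : WStep B l' B') (hl : l ≠ .tau) (hl' : l' ≠ .tau)
    (H : ∀ A A' B B', Step A l A' → Step B l' B' → Step (.par A B) l'' (.par A' B')) :
    WStep (.par A B) l'' (.par A' B') := by
  rcases h with ⟨h, _⟩ | ⟨_, C, D, h1, h2, h3⟩
  · exact absurd h hl
  rcases h' with ⟨h, _⟩ | ⟨_, C', D', h1', h2', h3'⟩
  · exact absurd h hl'
  have key : ∀ {A A' B B' : Beh Acc 0}, TauSteps A A' → TauSteps B B' →
      TauSteps (.par A B) (.par A' B') := fun {A A' B B'} h h' =>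
    (h.map (F := (Beh.par · B)) fun _ _ h => h.parL _).trans
      (h'.map (F := Beh.par A') fun _ _ h => h.parR _)
  exact ((of_step (H _ _ _ _ h2 h2')).head (key h1 h1')).tail (key h3 h3')

end WStep

/-! ## The simulation preorder -/

namespace Sim

theorem step {A B B' : Beh Acc 0} {l : Label Acc} (h : Sim A B) (hB : Step B l B') :
    ∃ A', WStep A l A' ∧ Sim A' B' := by
  obtain ⟨R, hR, h⟩ := h
  obtain ⟨A', hA, h'⟩ := hR _ _ h _ _ hB
  exact ⟨A', hA, R, hR, h'⟩

/-- Adding the one pair (A, B) to the largest simulation gives a simulation again. -/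
theorem of_step {A B : Beh Acc 0}
    (h : ∀ l B', Step B l B' → ∃ A', WStep A l A' ∧ Sim A' B') : Sim A B := by
  refine ⟨fun X Y => (X = A ∧ Y = B) ∨ Sim X Y, ?_, .inl ⟨rfl, rfl⟩⟩
  rintro X Y (⟨rfl, rfl⟩ | hXY) l Y' hY
  · obtain ⟨A', h1, h2⟩ := h l Y' hY
    exact ⟨A', h1, .inr h2⟩
  · obtain ⟨A', h1, h2⟩ := hXY.step hY
    exact ⟨A', h1, .inr h2⟩

/-- A strong simulation is a simulation. -/
theorem of_strong (R : Beh Acc 0 → Beh Acc 0 → Prop)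
    (hR : ∀ A B, R A B → ∀ l B', Step B l B' → ∃ A', Step A l A' ∧ R A' B') {A B : Beh Acc 0}
    (h : R A B) : Sim A B := by
  refine ⟨R, fun X Y hXY l Y' hY => ?_, h⟩
  obtain ⟨X', h1, h2⟩ := hR _ _ hXY _ _ hY
  exact ⟨X', .of_step h1, h2⟩

theorem refl (A : Beh Acc 0) : Sim A A :=
  of_strong Eq (by rintro A _ rfl l B' h; exact ⟨B', h, rfl⟩) rfl

theorem tauSteps {A B B' : Beh Acc 0} (h : Sim A B) (hB : TauSteps B B') :
    ∃ A', TauSteps A A' ∧ Sim A' B' := by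
  induction hB with
  | refl => exact ⟨A, .refl, h⟩
  | tail _ hB ih =>
    obtain ⟨A', h1, h2⟩ := ih
    obtain ⟨A'', h3, h4⟩ := h2.step hB
    exact ⟨A'', h1.trans h3.tauSteps, h4⟩

theorem wstep {A B B' : Beh Acc 0} {l : Label Acc} (h : Sim A B) (hB : WStep B l B') :
    ∃ A', WStep A l A' ∧ Sim A' B' := by
  rcases hB with ⟨rfl, hB⟩ | ⟨hl, C, D, h1, h2, h3⟩
  · obtain ⟨A', h1, h2⟩ := h.tauSteps hB
    exact ⟨A', .inl ⟨rfl, h1⟩, h2⟩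
  · obtain ⟨A₁, h4, h5⟩ := h.tauSteps h1
    obtain ⟨A₂, h6, h7⟩ := h5.step h2
    obtain ⟨A₃, h8, h9⟩ := h7.tauSteps h3
    exact ⟨A₃, (h6.head h4).tail h8, h9⟩

theorem trans {A B C : Beh Acc 0} (h : Sim A B) (h' : Sim B C) : Sim A C := by
  refine ⟨fun X Z => ∃ Y, Sim X Y ∧ Sim Y Z, ?_, B, h, h'⟩
  rintro X Z ⟨Y, h1, h2⟩ l Z' hZ
  obtain ⟨Y', h3, h4⟩ := h2.step hZ
  obtain ⟨X', h5, h6⟩ := h1.wstep h3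
  exact ⟨X', h5, Y', h6, h4⟩

theorem par {A B C D : Beh Acc 0} (h : Sim A B) (h' : Sim C D) :
    Sim (.par A C) (.par B D) := by
  refine ⟨fun X Y => ∃ A B C D, Sim A B ∧ Sim C D ∧ X = .par A C ∧ Y = .par B D, ?_,
    A, B, C, D, h, h', rfl, rfl⟩
  rintro _ _ ⟨A, B, C, D, h, h', rfl, rfl⟩ l Y' hY
  rcases hY.par_inv with ⟨B', rfl, hB⟩ | ⟨D', rfl, hD⟩ | ⟨B', D', x, y, rfl, hs, hl⟩
  · obtain ⟨A', h1, h2⟩ := h.step hB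
    exact ⟨_, h1.map (F := (Beh.par · C)) (fun _ _ h => h.parL _) (fun _ _ h => h.parL _) id,
      _, _, _, _, h2, h', rfl, rfl⟩
  · obtain ⟨C', h1, h2⟩ := h'.step hD
    exact ⟨_, h1.map (F := Beh.par A) (fun _ _ h => h.parR _) (fun _ _ h => h.parR _) id,
      _, _, _, _, h, h2, rfl, rfl⟩
  · rcases hs with ⟨hB, hD⟩ | ⟨hB, hD⟩ <;> obtain ⟨A', h1, h2⟩ := h.step hB <;>
      obtain ⟨C', h3, h4⟩ := h'.step hD
    · exact ⟨_, (h1.com h3 nofun nofun fun _ _ _ _ h h' => .comL h h').contract hl,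
        _, _, _, _, h2, h4, rfl, rfl⟩
    · exact ⟨_, (h1.com h3 nofun nofun fun _ _ _ _ h h' => .comR h h').contract hl,
        _, _, _, _, h2, h4, rfl, rfl⟩

theorem sub {A B : Beh Acc 0} (h : Sim A B) (θ : List (Var × Val)) :
    Sim (.sub θ A) (.sub θ B) := by
  refine ⟨fun X Y => ∃ A B, Sim A B ∧ X = .sub θ A ∧ Y = .sub θ B, ?_, A, B, h, rfl, rfl⟩
  rintro _ _ ⟨A, B, h, rfl, rfl⟩ l Y' hY
  obtain ⟨B', l₀, l₁, rfl, hB, hl, hl'⟩ := hY.sub_inv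
  obtain ⟨A', h1, h2⟩ := h.step hB
  refine ⟨_, (h1.map (F := Beh.sub θ) (fun _ _ h => h.sub rfl) (fun _ _ h => h.sub hl) ?_).contract
    hl', _, _, h2, rfl, rfl⟩
  rintro rfl
  simpa [Label.subst] using hl.symm

theorem par_comm (A B : Beh Acc 0) : Sim (.par A B) (.par B A) := by
  refine of_strong (fun X Y => ∃ A B, X = .par A B ∧ Y = .par B A) ?_ ⟨A, B, rfl, rfl⟩
  rintro _ _ ⟨A, B, rfl, rfl⟩ l Y' hY
  rcases hY.par_inv with ⟨B', rfl, hB⟩ | ⟨D', rfl, hD⟩ | ⟨B', D', x, y, rfl, hs | hs, hl⟩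
  · exact ⟨_, hB.parR _, _, _, rfl, rfl⟩
  · exact ⟨_, hD.parL _, _, _, rfl, rfl⟩
  · exact ⟨_, (Step.comR hs.2 hs.1).contract hl, _, _, rfl, rfl⟩
  · exact ⟨_, (Step.comL hs.2 hs.1).contract hl, _, _, rfl, rfl⟩

theorem par_assoc (A B C : Beh Acc 0) : Sim (.par A (.par B C)) (.par (.par A B) C) := by
  refine of_strong (fun X Y => ∃ A B C, X = .par A (.par B C) ∧ Y = .par (.par A B) C) ?_
    ⟨A, B, C, rfl, rfl⟩
  rintro _ _ ⟨A, B, C, rfl, rfl⟩ l Y' hY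
  rcases hY.par_inv with ⟨X, rfl, hX⟩ | ⟨C', rfl, hC⟩ | ⟨X, C', x, y, rfl, hs, hl⟩
  · rcases hX.par_inv with ⟨A', rfl, hA⟩ | ⟨B', rfl, hB⟩ | ⟨A', B', x, y, rfl, hs | hs, hl⟩
    · exact ⟨_, hA.parL _, _, _, _, rfl, rfl⟩
    · exact ⟨_, (hB.parL _).parR _, _, _, _, rfl, rfl⟩
    · exact ⟨_, (Step.comL hs.1 (hs.2.parL _)).contract hl, _, _, _, rfl, rfl⟩
    · exact ⟨_, (Step.comR hs.1 (hs.2.parL _)).contract hl, _, _, _, rfl, rfl⟩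
  · exact ⟨_, (hC.parR _).parR _, _, _, _, rfl, rfl⟩
  · rcases hs with ⟨hX, hC⟩ | ⟨hX, hC⟩ <;>
      rcases hX.par_inv with ⟨A', rfl, hA⟩ | ⟨B', rfl, hB⟩ | ⟨_, _, _, _, _, _, hl' | ⟨hl', _⟩⟩
    · exact ⟨_, (Step.comL hA (hC.parR _)).contract hl, _, _, _, rfl, rfl⟩
    · exact ⟨_, ((Step.comL hB hC).contract hl).parR _, _, _, _, rfl, rfl⟩
    · cases hl'
    · cases hl'
    · exact ⟨_, (Step.comR hA (hC.parR _)).contract hl, _, _, _, rfl, rfl⟩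
    · exact ⟨_, ((Step.comR hB hC).contract hl).parR _, _, _, _, rfl, rfl⟩
    · cases hl'
    · cases hl'

theorem par_assoc' (A B C : Beh Acc 0) : Sim (.par (.par A B) C) (.par A (.par B C)) :=
  (par_comm _ _).trans <| ((refl C).par (par_comm A B)).trans <| (par_assoc C B A).trans <|
    ((par_comm _ _).trans <| (refl A).par (par_comm C B))

theorem par_left (A B : Beh Acc 0) : Sim (.par A B) A := by
  refine of_strong (fun X Y => X = .par Y B) ?_ rfl
  rintro _ Y rfl l Y' hY
  exact ⟨_, hY.parL _, rfl⟩

theorem par_zero (A : Beh Acc 0) : Sim A (.par A .zero) := by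
  refine of_strong (fun X Y => Y = .par X .zero) ?_ rfl
  rintro X _ rfl l Y' hY
  rcases hY.par_inv with ⟨X', rfl, hX⟩ | ⟨_, _, h⟩ | ⟨_, _, x, y, _, ⟨_, h⟩ | ⟨_, h⟩, _⟩
  · exact ⟨_, hX, rfl⟩
  all_goals exact h.zero_inv.elim

theorem rep_unfold (A : Beh Acc 0) : Sim (.rep A) (.par (.rep A) A) :=
  Sim.trans (of_step fun _ B' h => ⟨B', .of_step h.rep, refl _⟩) (par_comm A (.rep A))

theorem pre {θ : List (Var × Val)} {a a' : Act} {A B : Beh Acc 0}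
    (ha : (Label.ofAct a : Label Acc).subst (subFun θ) = some (.ofAct a')) (h : Sim (.sub θ A) B) :
    Sim (.sub θ (.pre a A)) (.pre a' B) := by
  refine of_step fun l B' hB => ?_
  obtain ⟨rfl, rfl⟩ := hB.pre_inv
  exact ⟨_, .of_step ((Step.act a A).sub ha), h⟩

theorem acc {θ : List (Var × Val)} {x y : Var} {ξ : Acc} (A : Beh Acc 0)
    (hx : subFun θ x = .var y) : Sim (.sub θ (.acc x ξ A)) (.acc y ξ (.sub θ A)) := by
  refine of_step fun l B' hB => ?_
  obtain ⟨rfl, rfl⟩ := hB.acc_inv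
  exact ⟨_, .of_step ((Step.acc x ξ A).sub (by simp [Label.subst, hx, Val.var?])), refl _⟩

end Sim

/-! ## Delayed substitutions -/

theorem Label.subst_eq_inp {θ : Var → Val} {l : Label Acc} {x : Var} :
    l.subst θ = some (inp x) ↔ ∃ a, l = inp a ∧ θ a = .var x := by
  cases l <;> simp [subst, Val.var?_eq_some]

theorem Label.subst_eq_out {θ : Var → Val} {l : Label Acc} {x : Var} :
    l.subst θ = some (out x) ↔ ∃ a, l = out a ∧ θ a = .var x := by
  cases l <;> simp [subst, Val.var?_eq_some]

/-- `B` is obtained from `A` by pushing the delayed substitution `θ` below compositions and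
replications. -/
inductive PushSub (θ : List (Var × Val)) : Beh Acc 0 → Beh Acc 0 → Prop
  | base (A) : PushSub θ A (.sub θ A)
  | par {A A' B B'} : PushSub θ A B → PushSub θ A' B' → PushSub θ (.par A A') (.par B B')
  | rep (A) : PushSub θ (.rep A) (.rep (.sub θ A))

theorem Step.sub_inp {θ : List (Var × Val)} {A A' : Beh Acc 0} {x : Var}
    (h : Step (.sub θ A) (.inp x) (.sub θ A')) : ∃ a, Step A (.inp a) A' ∧ subFun θ a = .var x := by
  obtain ⟨A', l₀, l₁, hA, hs, hl, rfl | ⟨h, _⟩⟩ := h.sub_inv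
  · obtain ⟨a, rfl, ha⟩ := Label.subst_eq_inp.mp hl
    cases hA
    exact ⟨a, hs, ha⟩
  · cases h

theorem Step.sub_out {θ : List (Var × Val)} {A A' : Beh Acc 0} {x : Var}
    (h : Step (.sub θ A) (.out x) (.sub θ A')) : ∃ a, Step A (.out a) A' ∧ subFun θ a = .var x := by
  obtain ⟨A', l₀, l₁, hA, hs, hl, rfl | ⟨h, _⟩⟩ := h.sub_inv
  · obtain ⟨a, rfl, ha⟩ := Label.subst_eq_out.mp hl
    cases hA
    exact ⟨a, hs, ha⟩
  · cases h

/-- The induction is on the transition, since replication unfolds *⟨θ⟩A to the larger type ⟨θ⟩A |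
*⟨θ⟩A. The latter is again θ pushed into A | *A, which is why the relation mixes all three shapes.
-/
theorem PushSub.step {θ : List (Var × Val)} {X Y Y' : Beh Acc 0} {l : Label Acc}
    (h : PushSub θ X Y) (hY : Step Y l Y') :
    ∃ X', Step (.sub θ X) l (.sub θ X') ∧ PushSub θ X' Y' := by
  induction hY generalizing X with
  | tau hs ih =>
    obtain ⟨X', h1, h2⟩ := ih h
    exact ⟨X', h1.tau, h2⟩
  | sub hs hl => cases h; exact ⟨_, hs.sub hl, .base _⟩
  | parL B hs ih =>
    cases h with
    | par h h' =>
      obtain ⟨X', h1, h2⟩ := ih h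
      obtain ⟨_, l₀, l₁, hX, hs, hl, hl'⟩ := h1.sub_inv
      cases hX
      exact ⟨_, ((hs.parL _).sub hl).contract hl', h2.par h'⟩
  | parR B hs ih =>
    cases h with
    | par h h' =>
      obtain ⟨X', h1, h2⟩ := ih h'
      obtain ⟨_, l₀, l₁, hX, hs, hl, hl'⟩ := h1.sub_inv
      cases hX
      exact ⟨_, ((hs.parR _).sub hl).contract hl', h.par h2⟩
  | comL hs hs' ih ih' =>
    cases h with
    | par h h' =>
      obtain ⟨X', h1, h2⟩ := ih h
      obtain ⟨X'', h3, h4⟩ := ih' h'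
      obtain ⟨a, h5, ha⟩ := h1.sub_inp
      obtain ⟨b, h6, hb⟩ := h3.sub_out
      exact ⟨_, (Step.comL h5 h6).sub (Label.subst_eq_com.mpr ⟨a, b, rfl, ha, hb⟩), h2.par h4⟩
  | comR hs hs' ih ih' =>
    cases h with
    | par h h' =>
      obtain ⟨X', h1, h2⟩ := ih h
      obtain ⟨X'', h3, h4⟩ := ih' h'
      obtain ⟨a, h5, ha⟩ := h1.sub_out
      obtain ⟨b, h6, hb⟩ := h3.sub_inp
      exact ⟨_, (Step.comR h5 h6).sub (Label.subst_eq_com.mpr ⟨b, a, rfl, hb, ha⟩), h2.par h4⟩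
  | rep hs ih =>
    cases h with
    | rep A =>
      obtain ⟨X', h1, h2⟩ := ih (.par (.base A) (.rep A))
      obtain ⟨_, l₀, l₁, hX, hs, hl, hl'⟩ := h1.sub_inv
      cases hX
      exact ⟨_, (hs.rep.sub hl).contract hl', h2⟩
  | _ => cases h

theorem PushSub.sim {θ : List (Var × Val)} {X Y : Beh Acc 0} (h : PushSub θ X Y) :
    Sim (.sub θ X) Y := by
  refine Sim.of_strong (fun A B => ∃ X, A = .sub θ X ∧ PushSub θ X B) ?_ ⟨X, rfl, h⟩
  rintro _ B ⟨X, rfl, h⟩ l B' hB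
  obtain ⟨X', h1, h2⟩ := h.step hB
  exact ⟨_, h1, X', rfl, h2⟩

theorem Sim.sub_comp {θ₁ θ₂ θ₃ : List (Var × Val)} (A : Beh Acc 0)
    (h : ∀ z ∈ A.fv, subFun θ₃ z = (subFun θ₁ z).subst (subFun θ₂)) :
    Sim (.sub θ₂ (.sub θ₁ A)) (.sub θ₃ A) := by
  refine of_strong (fun X Y => ∃ B : Beh Acc 0, B.fv ⊆ A.fv ∧ X = .sub θ₂ (.sub θ₁ B) ∧
    Y = .sub θ₃ B) ?_ ⟨A, subset_rfl, rfl, rfl⟩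
  rintro _ _ ⟨B, hB, rfl, rfl⟩ l Y' hY
  obtain ⟨B', l₀, l₁, rfl, hs, hl, hl'⟩ := hY.sub_inv
  rw [Label.subst_comp fun z hz => h z (hB (hs.fv_subset.1 hz)), Option.bind_eq_some_iff] at hl
  obtain ⟨l₂, h2, h3⟩ := hl
  exact ⟨_, ((hs.sub h2).sub h3).contract hl', _, hs.fv_subset.2.trans hB, rfl, rfl⟩

/-- Injectivity cannot be dropped in this direction. If θ₁ identified a and b, then {a, b̄} could
contract to τ below θ₂ and survive, even when θ₂ replaces the common channel by a boolean; the
one-stage substitution would block that move. -/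
theorem Sim.sub_comp' {θ₁ θ₂ θ₃ : List (Var × Val)} (A : Beh Acc 0)
    (h : ∀ z ∈ A.fv, subFun θ₃ z = (subFun θ₁ z).subst (subFun θ₂))
    (hinj : ∀ a ∈ A.fv, ∀ b ∈ A.fv, subFun θ₁ a = subFun θ₁ b → a = b) :
    Sim (.sub θ₃ A) (.sub θ₂ (.sub θ₁ A)) := by
  refine of_strong (fun X Y => ∃ B : Beh Acc 0, B.fv ⊆ A.fv ∧ X = .sub θ₃ B ∧
    Y = .sub θ₂ (.sub θ₁ B)) ?_ ⟨A, subset_rfl, rfl, rfl⟩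
  rintro _ _ ⟨B, hB, rfl, rfl⟩ l Y' hY
  obtain ⟨_, l₂, l₃, rfl, ht, h2, h3⟩ := hY.sub_inv
  obtain ⟨B', l₀, l₁, rfl, hs, hl, hl' | ⟨rfl, x, rfl⟩⟩ := ht.sub_inv
  · subst hl'
    have := Label.subst_comp (l := l₀) fun z hz => h z (hB (hs.fv_subset.1 hz))
    rw [hl, Option.bind_some, h2] at this
    exact ⟨_, (hs.sub this).contract h3, _, hs.fv_subset.2.trans hB, rfl, rfl⟩
  · obtain ⟨a, b, rfl, ha, hb⟩ := Label.subst_eq_com.mp hl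
    have hfv := hs.fv_subset.1
    obtain rfl := hinj a (hB (hfv (by simp [Label.target]))) b (hB (hfv (by simp [Label.target])))
      (ha.trans hb.symm)
    cases h2
    exact ⟨_, (hs.tau.sub rfl).contract h3, _, hs.fv_subset.2.trans hB, rfl, rfl⟩

/-- A behaviour below a substitution for `S` is simulated by its part on `S`, below the
substitution, together with the rest. -/
theorem Sim.proj_par_excl {θ : List (Var × Val)} {S : Finset Var}
    (hθ : ∀ z ∉ S, subFun θ z = .var z) (A : Beh Acc 0) :
    Sim (.par (.sub θ (.proj A S)) (.excl A S)) (.sub θ A) := by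
  refine ⟨fun X Y => ∃ A, X = .par (.sub θ (.proj A S)) (.excl A S) ∧ Y = .sub θ A, ?_,
    A, rfl, rfl⟩
  rintro _ _ ⟨A, rfl, rfl⟩ l Y' hY
  obtain ⟨A', l₀, l₁, rfl, hs, hl, hl'⟩ := hY.sub_inv
  refine ⟨_, WStep.contract ?_ hl', A', rfl, rfl⟩
  -- A label within S is shown by the projection and one outside S by the exclusion; the other half
  -- follows by τ, so both come from the same residual again.
  by_cases h1 : l₀.target ⊆ S
  · exact (WStep.of_step (((hs.projIn h1).sub hl).parL _)).tail
      (.single ((hs.exclIn h1).parR _))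
  by_cases h2 : Disjoint l₀.target S
  · have := Label.subst_var (l := l₀) (θ := subFun θ)
      fun z hz => hθ z (Finset.disjoint_left.mp h2 hz)
    rw [hl, Option.some.injEq] at this
    subst this
    exact (WStep.of_step ((hs.exclOut h2).parR _)).tail
      (.single (((hs.projOut h2).sub rfl).parL _))
  · cases l₀ with
    | tau => simp [Label.target] at h1
    | inp x | out x | acc x => simp_all [Label.target]
    | com x y =>
      obtain ⟨x', y', hx', hy', rfl⟩ : ∃ x' y', subFun θ x = .var x' ∧ subFun θ y = .var y' ∧
          l₁ = .com x' y' := by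
        simp only [Label.subst, Option.map₂_eq_some_iff, Option.mem_def, Val.var?_eq_some] at hl
        obtain ⟨x', y', hx', hy', rfl⟩ := hl
        exact ⟨x', y', hx', hy', rfl⟩
      have hi : (Label.inp x : Label Acc).subst (subFun θ) = some (.inp x') :=
        Label.subst_eq_inp.mpr ⟨x, rfl, hx'⟩
      have ho : (Label.out y : Label Acc).subst (subFun θ) = some (.out y') :=
        Label.subst_eq_out.mpr ⟨y, rfl, hy'⟩
      -- Neither half admits this label, which has one end in S. The order is chosen so that the end
      -- in S comes first: the exclusion catches up with it silently, the halves synchronise, and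
      -- the projection then catches up with the other end.
      obtain ⟨⟨B, hB1, hB2⟩, C, hC1, hC2⟩ := hs.com_split
      by_cases hx : x ∈ S
      · have hy : y ∉ S := fun hy => h1 (by simp [Label.target, Finset.insert_subset_iff, hx, hy])
        rw [hθ y hy, Val.var.injEq] at hy'
        subst hy'
        have sx : (Label.inp x : Label Acc).target ⊆ S := Finset.singleton_subset_iff.mpr hx
        have sy : Disjoint (Label.out y : Label Acc).target S :=
          Finset.disjoint_singleton_left.mpr hy
        exact ((WStep.of_step (Step.comL ((hB1.projIn sx).sub hi) (hB2.exclOut sy))).head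
          (.single ((hB1.exclIn sx).parR _))).tail (.single (((hB2.projOut sy).sub rfl).parL _))
      · have hy : y ∈ S := by
          by_contra hy
          exact h2 (by simp [Label.target, hx, hy])
        rw [hθ x hx, Val.var.injEq] at hx'
        subst hx'
        have sy : (Label.out y : Label Acc).target ⊆ S := Finset.singleton_subset_iff.mpr hy
        have sx : Disjoint (Label.inp x : Label Acc).target S :=
          Finset.disjoint_singleton_left.mpr hx
        exact ((WStep.of_step (Step.comR ((hC1.projIn sy).sub ho) (hC2.exclOut sx))).head
          (.single ((hC1.exclIn sy).parR _))).tail (.single (((hC2.projOut sx).sub rfl).parL _))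

/-- `θ'` is `θ` except that it renames `ys` to `ys'`, which are fresh with respect to the values
of `θ` on `F`. -/
structure ExtendsByRenaming {n : ℕ} (ys ys' : Fin n → Var) (θ θ' : Var → Val)
    (F : Finset Var) : Prop where
  inj : Function.Injective ys
  inj' : Function.Injective ys'
  on : ∀ i, θ' (ys i) = .var (ys' i)
  off : ∀ z, (∀ i, ys i ≠ z) → θ' z = θ z
  fresh : ∀ z ∈ F, (∀ i, ys i ≠ z) → ∀ i, θ z ≠ .var (ys' i)

namespace ExtendsByRenaming

variable {n : ℕ} {ys ys' : Fin n → Var} {θ θ' : Var → Val} {F : Finset Var}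

theorem mem_iff (h : ExtendsByRenaming ys ys' θ θ' F) {z x : Var} (hz : z ∈ F)
    (hx : θ' z = .var x) : x ∈ Finset.univ.image ys' ↔ z ∈ Finset.univ.image ys := by
  simp only [Finset.mem_image, Finset.mem_univ, true_and]
  constructor
  · rintro ⟨i, rfl⟩
    by_contra hn
    rw [not_exists] at hn
    rw [h.off z hn] at hx
    exact h.fresh z hz hn i hx
  · rintro ⟨i, rfl⟩
    rw [h.on, Val.var.injEq] at hx
    exact ⟨i, hx⟩

theorem target_subset_iff (h : ExtendsByRenaming ys ys' θ θ' F) {l l' : Label Acc}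
    (hl : l.target ⊆ F) (hl' : l.subst θ' = some l') :
    l'.target ⊆ Finset.univ.image ys' ↔ l.target ⊆ Finset.univ.image ys := by
  constructor
  · intro hs z hz
    obtain ⟨x, hx⟩ := Label.subst_defined hl' hz
    exact (h.mem_iff (hl hz) hx).mp (hs ((Label.mem_target_subst hl' x).mpr ⟨z, hz, hx⟩))
  · intro hs x hx
    obtain ⟨z, hz, hx⟩ := (Label.mem_target_subst hl' x).mp hx
    exact (h.mem_iff (hl hz) hx).mpr (hs hz)

theorem disjoint_iff (h : ExtendsByRenaming ys ys' θ θ' F) {l l' : Label Acc}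
    (hl : l.target ⊆ F) (hl' : l.subst θ' = some l') :
    Disjoint l'.target (Finset.univ.image ys') ↔ Disjoint l.target (Finset.univ.image ys) := by
  rw [Finset.disjoint_left, Finset.disjoint_left]
  constructor
  · intro hs z hz hzS
    obtain ⟨x, hx⟩ := Label.subst_defined hl' hz
    exact hs ((Label.mem_target_subst hl' x).mpr ⟨z, hz, hx⟩) ((h.mem_iff (hl hz) hx).mpr hzS)
  · intro hs x hx hxS
    obtain ⟨z, hz, hx⟩ := (Label.mem_target_subst hl' x).mp hx
    exact hs hz ((h.mem_iff (hl hz) hx).mp hxS)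

theorem subst_off (h : ExtendsByRenaming ys ys' θ θ' F) {l : Label Acc}
    (hl : Disjoint l.target (Finset.univ.image ys)) : l.subst θ = l.subst θ' := by
  refine Label.subst_congr fun z hz => (h.off z fun i hi => ?_).symm
  exact Finset.disjoint_left.mp hl hz (by simp [← hi])

theorem subst_on (h : ExtendsByRenaming ys ys' θ θ' F) {l : Label Acc}
    (hl : l.target ⊆ Finset.univ.image ys) :
    l.subst (subFun (List.ofFn fun i => (ys i, .var (ys' i)))) = l.subst θ' := by
  refine Label.subst_congr fun z hz => ?_
  obtain ⟨i, -, rfl⟩ := Finset.mem_image.mp (hl hz)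
  rw [h.on, subFun_ofFn_apply h.inj fun i => .var (ys' i)]

end ExtendsByRenaming

/-- A contracted communication has a single variable, so it cannot lie partly inside S. -/
theorem Label.Contracts.cases {l l' : Label Acc} (h : l.Contracts l') (S : Finset Var) :
    l = l' ∨ (l' = .tau ∧ (l.target ⊆ S ∨ Disjoint l.target S)) := by
  rcases h with h | ⟨h, x, rfl⟩
  · exact .inl h
  · exact .inr ⟨h, by by_cases hx : x ∈ S <;> simp [target, hx]⟩

theorem Label.Contracts.target_subset {l l' : Label Acc} (h : l.Contracts l') :
    l'.target ⊆ l.target := by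
  rcases h with rfl | ⟨rfl, x, rfl⟩ <;> simp [target]

/-! ### Delayed substitution under exclusion, projection and restriction. -/

section

variable {n : ℕ} {ys ys' : Fin n → Var} {θ θ' : List (Var × Val)} {A : Beh Acc 0}

/-- The transitions below a delayed substitution, sorted by whether the label is on the renamed
variables. -/
theorem ExtendsByRenaming.step_cases
    (h : ExtendsByRenaming ys ys' (subFun θ) (subFun θ') A.fv) {B X : Beh Acc 0} {l : Label Acc}
    (hB : B.fv ⊆ A.fv) (hs : Step (.sub θ' B) l X) :
    ∃ B' l₀, X = .sub θ' B' ∧ B'.fv ⊆ A.fv ∧ Step B l₀ B' ∧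
      ((l₀.target ⊆ Finset.univ.image ys ∧ l.target ⊆ Finset.univ.image ys' ∧
          ∃ l₁, l₀.subst (subFun (List.ofFn fun i => (ys i, .var (ys' i)))) = some l₁ ∧
            l₁.Contracts l) ∨
        (Disjoint l₀.target (Finset.univ.image ys) ∧ Disjoint l.target (Finset.univ.image ys') ∧
          ∃ l₁, l₀.subst (subFun θ) = some l₁ ∧ l₁.Contracts l) ∨
        (¬ l.target ⊆ Finset.univ.image ys' ∧ ¬ Disjoint l.target (Finset.univ.image ys'))) := by
  obtain ⟨B', l₀, l₁, rfl, hs, hl, hl'⟩ := hs.sub_inv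
  refine ⟨B', l₀, rfl, hs.fv_subset.2.trans hB, hs, ?_⟩
  have hF := hs.fv_subset.1.trans hB
  by_cases h1 : l₁.target ⊆ Finset.univ.image ys'
  · have h0 := (h.target_subset_iff hF hl).mp h1
    exact .inl ⟨h0, hl'.target_subset.trans h1, l₁, by rw [h.subst_on h0, hl], hl'⟩
  by_cases h2 : Disjoint l₁.target (Finset.univ.image ys')
  · have h0 := (h.disjoint_iff hF hl).mp h2
    exact .inr (.inl ⟨h0, h2.mono_left hl'.target_subset, l₁, by rw [h.subst_off h0, hl], hl'⟩)
  -- A label partly inside ys' was not contracted, so l itself is mixed, and exclusion and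
  -- projection will block it.
  · rcases hl'.cases (Finset.univ.image ys') with rfl | ⟨_, h3 | h3⟩
    · exact .inr (.inr ⟨h1, h2⟩)
    · exact absurd h3 h1
    · exact absurd h3 h2

theorem Label.eq_tau_of_target {l : Label Acc} {S : Finset Var} (h : l.target ⊆ S)
    (h' : Disjoint l.target S) : l = .tau := by
  have : l.target = ∅ := Finset.disjoint_self_iff_empty _ |>.mp (h'.mono_right h)
  cases l <;> simp_all [target]

/-- Freshness of ys' means that θ' sends a free variable into ys' exactly if it belongs to ys. So
the two exclusions hide the same transitions, and on the others θ and θ' agree. -/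
theorem Sim.excl_sub (h : ExtendsByRenaming ys ys' (subFun θ) (subFun θ') A.fv) :
    Sim (.sub θ (.excl A (Finset.univ.image ys))) (.excl (.sub θ' A) (Finset.univ.image ys')) := by
  refine of_strong (fun X Y => ∃ B : Beh Acc 0, B.fv ⊆ A.fv ∧
    X = .sub θ (.excl B (Finset.univ.image ys)) ∧
    Y = .excl (.sub θ' B) (Finset.univ.image ys')) ?_ ⟨A, subset_rfl, rfl, rfl⟩
  rintro _ _ ⟨B, hB, rfl, rfl⟩ l Y' hY
  obtain ⟨Z, rfl, ⟨l', ht, hS, rfl⟩ | ⟨ht, hS⟩⟩ := hY.excl_inv <;>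
    obtain ⟨B', l₀, rfl, hB', hs, ⟨h0, h1, l₁, h2, h3⟩ | ⟨h0, h1, l₁, h2, h3⟩ | ⟨h1, h2⟩⟩ :=
      h.step_cases hB ht
  · exact ⟨_, (hs.exclIn h0).sub rfl, B', hB', rfl, rfl⟩
  · have := Label.eq_tau_of_target hS h1
    subst this
    exact ⟨_, ((hs.exclOut h0).sub h2).contract h3, B', hB', rfl, rfl⟩
  · exact absurd hS h1
  · obtain rfl := Label.eq_tau_of_target h1 hS
    exact ⟨_, (hs.exclIn h0).sub rfl, B', hB', rfl, rfl⟩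
  · exact ⟨_, ((hs.exclOut h0).sub h2).contract h3, B', hB', rfl, rfl⟩
  · exact absurd hS h2

/-- Only labels on ys remain visible, and there θ' is just the renaming of ys to ys'. -/
theorem Sim.proj_sub (h : ExtendsByRenaming ys ys' (subFun θ) (subFun θ') A.fv) :
    Sim (.sub (List.ofFn fun i => (ys i, .var (ys' i))) (.proj A (Finset.univ.image ys)))
      (.proj (.sub θ' A) (Finset.univ.image ys')) := by
  refine of_strong (fun X Y => ∃ B : Beh Acc 0, B.fv ⊆ A.fv ∧
    X = .sub (List.ofFn fun i => (ys i, .var (ys' i))) (.proj B (Finset.univ.image ys)) ∧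
    Y = .proj (.sub θ' B) (Finset.univ.image ys')) ?_ ⟨A, subset_rfl, rfl, rfl⟩
  rintro _ _ ⟨B, hB, rfl, rfl⟩ l Y' hY
  obtain ⟨Z, rfl, ⟨l', ht, hS, rfl⟩ | ⟨ht, hS⟩⟩ := hY.proj_inv <;>
    obtain ⟨B', l₀, rfl, hB', hs, ⟨h0, h1, l₁, h2, h3⟩ | ⟨h0, h1, l₁, h2, h3⟩ | ⟨h1, h2⟩⟩ :=
      h.step_cases hB ht
  · obtain rfl := Label.eq_tau_of_target h1 hS
    exact ⟨_, ((hs.projIn h0).sub h2).contract h3, B', hB', rfl, rfl⟩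
  · exact ⟨_, (hs.projOut h0).sub rfl, B', hB', rfl, rfl⟩
  · exact absurd hS h2
  · exact ⟨_, ((hs.projIn h0).sub h2).contract h3, B', hB', rfl, rfl⟩
  · obtain rfl := Label.eq_tau_of_target hS h1
    exact ⟨_, (hs.projOut h0).sub rfl, B', hB', rfl, rfl⟩
  · exact absurd hS h1

end

theorem image_singleton (x : Var) : Finset.univ.image ![x] = {x} := by
  simp

theorem Sim.nu_sub {x x' : Var} {θ θ' : List (Var × Val)} {A : Beh Acc 0}
    (h : ExtendsByRenaming ![x] ![x'] (subFun θ) (subFun θ') A.fv) :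
    Sim (.sub θ (.nu (A.rename (closeMap ![x])))) (.nu ((Beh.sub θ' A).rename (closeMap ![x']))) := by
  refine of_strong (fun X Y => ∃ B : Beh Acc 0, B.fv ⊆ A.fv ∧
    X = .sub θ (.nu (B.rename (closeMap ![x]))) ∧
    Y = .nu ((Beh.sub θ' B).rename (closeMap ![x']))) ?_ ⟨A, subset_rfl, rfl, rfl⟩
  rintro _ _ ⟨B, hB, rfl, rfl⟩ l Y' hY
  obtain ⟨_, rfl, hu⟩ := hY.nu_inv
  obtain ⟨l', Z, hl, rfl, ht⟩ := hu.rename_inv (closeMap_injective (singleton_injective x'))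
  obtain ⟨rfl, hx'⟩ := Label.rename_close_shift hl.symm
  have hS : Disjoint l'.target (Finset.univ.image ![x']) := by simpa using hx'
  have hc := closeMap_injective (singleton_injective x)
  obtain ⟨B', l₀, rfl, hB', hs, ⟨h0, h1, l₁, h2, h3⟩ | ⟨h0, h1, l₁, h2, h3⟩ |
    ⟨h1, h2⟩⟩ := h.step_cases hB ht
  -- The outer label is τ, but B may have communicated on x, which is to be bound. That
  -- communication is contracted to τ before the binder is put back.
  · obtain rfl := Label.eq_tau_of_target h1 hS
    have : Step B .tau B' := by
      rcases h3 with rfl | ⟨_, y, rfl⟩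
      · rwa [Label.subst_eq_tau.mp h2] at hs
      · obtain ⟨a, b, rfl, -, -⟩ := Label.subst_eq_com.mp h2
        simp only [Label.target, image_singleton, Finset.insert_subset_iff,
          Finset.singleton_subset_iff, Finset.mem_singleton] at h0
        obtain ⟨rfl, rfl⟩ := h0
        exact hs.tau
    have h' := this.rename hc
    exact ⟨_, (Step.new (l := .tau) h').sub rfl, B', hB', rfl, rfl⟩
  · rw [image_singleton, Finset.disjoint_singleton_right] at h0
    have := hs.rename hc
    rw [Label.rename_close h0] at this
    exact ⟨_, ((Step.new this).sub h2).contract h3, B', hB', rfl, rfl⟩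
  · exact absurd hS h2

theorem Sim.sub_nil (A : Beh Acc 0) : Sim A (.sub [] A) := by
  refine of_strong (fun X Y => Y = .sub [] X) ?_ rfl
  rintro X _ rfl l Y' hY
  obtain ⟨X', l₀, l₁, rfl, hs, hl, hl'⟩ := hY.sub_inv
  rw [Label.subst_var (θ := subFun []) fun z _ => rfl, Option.some.injEq] at hl
  subst hl
  exact ⟨_, hs.contract hl', rfl⟩

/-! ## Scope extrusion -/

/-- Any channel on which B acts differs from x. Hence in a communication of A with B that leaves ν,
the action of A is not on the bound variable either and can itself cross ν; `com` and `com'` extract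
this from the shifted label. -/
theorem Sim.par_nu {x : Var} (A : Beh Acc 0) {B : Beh Acc 0} (hx : x ∉ B.fv) :
    Sim (.par (.nu (A.rename (closeMap ![x]))) B) (.nu ((Beh.par A B).rename (closeMap ![x]))) := by
  refine of_strong (fun X Y => ∃ A B : Beh Acc 0, x ∉ B.fv ∧
    X = .par (.nu (A.rename (closeMap ![x]))) B ∧
    Y = .nu ((Beh.par A B).rename (closeMap ![x]))) ?_ ⟨A, B, hx, rfl, rfl⟩
  rintro _ _ ⟨A, B, hx, rfl, rfl⟩ l Y' hY
  have hc := closeMap_injective (singleton_injective x)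
  have key : ∀ {a y : Var}, y ≠ x → closeMap ![x] y = y + 1 := fun hy =>
    closeMap_apply' fun i hi => hy (by simpa using hi.symm)
  have com : ∀ {a b : Var}, b ≠ x →
      (Label.com a (closeMap ![x] b) : Label Acc).Contracts (l.rename (· + 1)) →
      ∃ c, a = c + 1 ∧ (Label.com c b).Contracts l := by
    intro a b hb hl
    rw [key (a := a) hb] at hl
    rcases hl with hl | ⟨hl, y, hy⟩
    · obtain ⟨c, d, rfl, rfl, hd⟩ := Label.rename_eq_com.mp hl
      rw [Nat.succ_injective hd]
      exact ⟨c, rfl, .inl rfl⟩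
    · cases hy
      have : l = .tau := by cases l <;> simp_all [Label.rename]
      exact ⟨b, rfl, .inr ⟨this, b, rfl⟩⟩
  have com' : ∀ {a b : Var}, b ≠ x →
      (Label.com (closeMap ![x] b) a : Label Acc).Contracts (l.rename (· + 1)) →
      ∃ c, a = c + 1 ∧ (Label.com b c).Contracts l := by
    intro a b hb hl
    rw [key (a := a) hb] at hl
    rcases hl with hl | ⟨hl, y, hy⟩
    · obtain ⟨c, d, rfl, hc, rfl⟩ := Label.rename_eq_com.mp hl
      rw [Nat.succ_injective hc]
      exact ⟨d, rfl, .inl rfl⟩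
    · cases hy
      have : l = .tau := by cases l <;> simp_all [Label.rename]
      exact ⟨b, rfl, .inr ⟨this, b, rfl⟩⟩
  obtain ⟨_, rfl, hs⟩ := hY.nu_inv
  rcases hs.par_inv with ⟨X, rfl, ht⟩ | ⟨X, rfl, ht⟩ | ⟨X, X', a, b, rfl, ⟨ht, ht'⟩ | ⟨ht, ht'⟩, hl⟩
  · obtain ⟨l', A', hl, rfl, -⟩ := ht.rename_inv hc
    exact ⟨_, ht.new.parL _, A', B, hx, rfl, rfl⟩
  · obtain ⟨l', B', hl, rfl, hB⟩ := ht.rename_inv hc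
    obtain ⟨rfl, -⟩ := Label.rename_close_shift hl.symm
    exact ⟨_, hB.parR _, A, B', fun h => hx (hB.fv_subset.2 h), rfl, rfl⟩
  · obtain ⟨-, A', -, rfl, -⟩ := ht.rename_inv hc
    obtain ⟨l', B', hl', rfl, hB⟩ := ht'.rename_inv hc
    cases l' <;> simp only [Label.rename, reduceCtorEq, Label.out.injEq] at hl'
    subst hl'
    have hb := hB.fv_subset.1 (Finset.mem_singleton_self _)
    obtain ⟨c, rfl, hc⟩ := com (fun h => hx (h ▸ hb)) hl
    exact ⟨_, (Step.comL (Step.new ht) hB).contract hc, A', B',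
      fun h => hx (hB.fv_subset.2 h), rfl, rfl⟩
  · obtain ⟨-, A', -, rfl, -⟩ := ht.rename_inv hc
    obtain ⟨l', B', hl', rfl, hB⟩ := ht'.rename_inv hc
    cases l' <;> simp only [Label.rename, reduceCtorEq, Label.inp.injEq] at hl'
    subst hl'
    have hb := hB.fv_subset.1 (Finset.mem_singleton_self _)
    obtain ⟨c, rfl, hc⟩ := com' (fun h => hx (h ▸ hb)) hl
    exact ⟨_, (Step.comR (Step.new ht) hB).contract hc, A', B',
      fun h => hx (hB.fv_subset.2 h), rfl, rfl⟩

/-- The channels of B are outside S, so a communication with B whose label is not mixed lies outside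
S entirely, including the half done by A. The last clause lets A be replaced by its exclusion, which
still offers that half. -/
theorem Step.par_inv_sorted {A B X : Beh Acc 0} {l : Label Acc} {S : Finset Var}
    (hB : Disjoint S B.fv) (h : Step (.par A B) l X) (hl : l.target ⊆ S ∨ Disjoint l.target S) :
    (∃ A', X = .par A' B ∧ Step A l A') ∨
    (∃ B', X = .par A B' ∧ Step B l B' ∧ Disjoint l.target S ∧ B'.fv ⊆ B.fv) ∨
    ∃ A' B' l₁ l₂, X = .par A' B' ∧ Step A l₁ A' ∧ B'.fv ⊆ B.fv ∧ Disjoint l.target S ∧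
      Disjoint l₁.target S ∧ Step B l₂ B' ∧
      ∀ C C', Step C l₁ C' → Step (.par C B) l (.par C' B') := by
  rcases h.par_inv with ⟨A', rfl, hA⟩ | ⟨B', rfl, ht⟩ | ⟨A', B', x, y, rfl, hs, hc⟩
  · exact .inl ⟨A', rfl, hA⟩
  · refine .inr (.inl ⟨B', rfl, ht, ?_, ht.fv_subset.2⟩)
    exact (hB.mono_right ht.fv_subset.1).symm
  · have key : ∀ {x y : Var}, y ∈ B.fv → (l.target = {x, y} ∨ l = .tau ∧ x = y) →
        x ∉ S ∧ Disjoint l.target S := by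
      intro x y hy hxy
      have hyS : y ∉ S := fun h => Finset.disjoint_left.mp hB h hy
      rcases hxy with h | ⟨rfl, rfl⟩
      · rw [h] at hl ⊢
        simp only [Finset.insert_subset_iff, Finset.singleton_subset_iff, hyS, and_false,
          false_or] at hl
        exact ⟨fun hx => Finset.disjoint_left.mp hl (Finset.mem_insert_self _ _) hx, hl⟩
      · exact ⟨hyS, by simp [Label.target]⟩
    have hxy : l.target = {x, y} ∨ l = .tau ∧ x = y := by
      rcases hc with rfl | ⟨rfl, z, hz⟩
      · exact .inl rfl
      · cases hz; exact .inr ⟨rfl, rfl⟩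
    rcases hs with ⟨hA, ht⟩ | ⟨hA, ht⟩
    · obtain ⟨h1, h2⟩ := key (ht.fv_subset.1 (Finset.mem_singleton_self _)) hxy
      exact .inr (.inr ⟨A', B', _, _, rfl, hA, ht.fv_subset.2, h2,
        Finset.disjoint_singleton_left.mpr h1, ht, fun C C' hC => (Step.comL hC ht).contract hc⟩)
    · have hyx : l.target = {y, x} ∨ l = .tau ∧ y = x := by
        rwa [Finset.pair_comm, eq_comm (a := y)]
      obtain ⟨h1, h2⟩ := key (ht.fv_subset.1 (Finset.mem_singleton_self _)) hyx
      exact .inr (.inr ⟨A', B', _, _, rfl, hA, ht.fv_subset.2, h2,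
        Finset.disjoint_singleton_left.mpr h1, ht, fun C C' hC => (Step.comR hC ht).contract hc⟩)

theorem Sim.par_excl {S : Finset Var} (A : Beh Acc 0) {B : Beh Acc 0} (hB : Disjoint S B.fv) :
    Sim (.par (.excl A S) B) (.excl (.par A B) S) := by
  refine of_strong (fun X Y => ∃ A B : Beh Acc 0, Disjoint S B.fv ∧ X = .par (.excl A S) B ∧
    Y = .excl (.par A B) S) ?_ ⟨A, B, hB, rfl, rfl⟩
  rintro _ _ ⟨A, B, hB, rfl, rfl⟩ l Y' hY
  obtain ⟨Z, rfl, ⟨l', ht, hS, rfl⟩ | ⟨ht, hS⟩⟩ := hY.excl_inv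
  · rcases ht.par_inv_sorted hB (.inl hS) with ⟨A', rfl, hA⟩ | ⟨B', rfl, hs, hS', hB'⟩ |
      ⟨A', B', l₁, l₂, rfl, hA, hB', hS', hS₁, hs, hC⟩
    · exact ⟨_, (hA.exclIn hS).parL _, A', B, hB, rfl, rfl⟩
    · obtain rfl := Label.eq_tau_of_target hS hS'
      exact ⟨_, hs.parR _, A, B', hB.mono_right hB', rfl, rfl⟩
    · obtain rfl := Label.eq_tau_of_target hS hS'
      exact ⟨_, hC _ _ (hA.exclOut hS₁), A', B', hB.mono_right hB', rfl, rfl⟩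
  · rcases ht.par_inv_sorted hB (.inr hS) with ⟨A', rfl, hA⟩ | ⟨B', rfl, hs, hS', hB'⟩ |
      ⟨A', B', l₁, l₂, rfl, hA, hB', hS', hS₁, hs, hC⟩
    · exact ⟨_, (hA.exclOut hS).parL _, A', B, hB, rfl, rfl⟩
    · exact ⟨_, hs.parR _, A, B', hB.mono_right hB', rfl, rfl⟩
    · exact ⟨_, hC _ _ (hA.exclOut hS₁), A', B', hB.mono_right hB', rfl, rfl⟩

/-- Moves of B alone are invisible on S and are matched by no step at all; a communication with B is
matched by the silent half of A. -/
theorem Sim.proj_par {S : Finset Var} (A : Beh Acc 0) {B : Beh Acc 0} (hB : Disjoint S B.fv) :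
    Sim (.proj A S) (.proj (.par A B) S) := by
  refine ⟨fun X Y => ∃ A B : Beh Acc 0, Disjoint S B.fv ∧ X = .proj A S ∧
    Y = .proj (.par A B) S, ?_, ⟨A, B, hB, rfl, rfl⟩⟩
  rintro _ _ ⟨A, B, hB, rfl, rfl⟩ l Y' hY
  obtain ⟨Z, rfl, ⟨l', ht, hS, rfl⟩ | ⟨ht, hS⟩⟩ := hY.proj_inv
  · rcases ht.par_inv_sorted hB (.inr hS) with ⟨A', rfl, hA⟩ | ⟨B', rfl, hs, hS', hB'⟩ |
      ⟨A', B', l₁, l₂, rfl, hA, hB', hS', hS₁, hs, hC⟩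
    · exact ⟨_, .of_step (hA.projOut hS), A', B, hB, rfl, rfl⟩
    · exact ⟨_, .refl _, A, B', hB.mono_right hB', rfl, rfl⟩
    · exact ⟨_, .of_step (hA.projOut hS₁), A', B', hB.mono_right hB', rfl, rfl⟩
  · rcases ht.par_inv_sorted hB (.inl hS) with ⟨A', rfl, hA⟩ | ⟨B', rfl, hs, hS', hB'⟩ |
      ⟨A', B', l₁, l₂, rfl, hA, hB', hS', hS₁, hs, hC⟩
    · exact ⟨_, .of_step (hA.projIn hS), A', B, hB, rfl, rfl⟩
    · obtain rfl := Label.eq_tau_of_target hS hS'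
      exact ⟨_, .refl _, A, B', hB.mono_right hB', rfl, rfl⟩
    · obtain rfl := Label.eq_tau_of_target hS hS'
      exact ⟨_, .of_step (hA.projOut hS₁), A', B', hB.mono_right hB', rfl, rfl⟩

/-! ## Traces -/

theorem WTrace.of_sim {x : Var} {A B : Beh Acc 0} {s : List Acc} (h : Sim A B)
    (hB : WTrace x B s) : WTrace x A s := by
  induction hB generalizing A with
  | nil => exact .nil _
  | cons hs _ ih =>
    obtain ⟨A', h1, h2⟩ := h.wstep hs
    exact .cons h1 (ih h2)

theorem WTrace.head {x : Var} {A B : Beh Acc 0} {s : List Acc} (h : TauSteps A B)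
    (hB : WTrace x B s) : WTrace x A s := by
  cases hB with
  | nil => exact .nil _
  | cons hs ht => exact .cons (hs.head h) ht

/-- The projection has only labels on x, so renaming x to x' cannot create a contraction that was
not possible before. -/
theorem Step.sub_proj_inv {x x' : Var} {A X : Beh Acc 0} {l : Label Acc}
    (h : Step (.sub (List.ofFn fun i => (![x] i, .var (![x'] i))) (.proj A {x})) l X) :
    ∃ A', X = .sub (List.ofFn fun i => (![x] i, .var (![x'] i))) (.proj A' {x}) ∧
      (l = .tau → Step (.proj A {x}) .tau (.proj A' {x})) ∧
      ∀ ξ, l = .acc x' ξ → Step (.proj A {x}) (.acc x ξ) (.proj A' {x}) := by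
  obtain ⟨_, l₀, l₁, rfl, hs, hl, hl'⟩ := h.sub_inv
  obtain ⟨A', rfl, -⟩ := hs.proj_inv
  have hS : l₀.target ⊆ {x} := by
    obtain ⟨_, -, ⟨_, -, -, rfl⟩ | ⟨-, hS⟩⟩ := hs.proj_inv
    · simp [Label.target]
    · exact hS
  refine ⟨A', rfl, ?_, ?_⟩
  · rintro rfl
    rcases hl' with rfl | ⟨_, y, rfl⟩
    · rwa [Label.subst_eq_tau.mp hl] at hs
    · obtain ⟨a, b, rfl, -, -⟩ := Label.subst_eq_com.mp hl
      simp only [Label.target, Finset.insert_subset_iff, Finset.singleton_subset_iff,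
        Finset.mem_singleton] at hS
      obtain ⟨rfl, rfl⟩ := hS
      exact hs.tau
  · rintro ξ rfl
    rcases hl' with rfl | ⟨h, _⟩
    · cases l₀ <;> simp [Label.subst] at hl
      obtain ⟨_, rfl⟩ := hl.2
      rw [Label.target, Finset.singleton_subset_iff, Finset.mem_singleton] at hS
      rwa [hS] at hs
    · cases h

theorem TauSteps.sub_proj_inv {x x' : Var} {A X : Beh Acc 0}
    (h : TauSteps (.sub (List.ofFn fun i => (![x] i, .var (![x'] i))) (.proj A {x})) X) :
    ∃ A', X = .sub (List.ofFn fun i => (![x] i, .var (![x'] i))) (.proj A' {x}) ∧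
      TauSteps (.proj A {x}) (.proj A' {x}) := by
  induction h with
  | refl => exact ⟨A, rfl, .refl⟩
  | tail _ hs ih =>
    obtain ⟨B, rfl, hB⟩ := ih
    obtain ⟨A', rfl, h, -⟩ := hs.sub_proj_inv
    exact ⟨A', rfl, hB.tail (h rfl)⟩

theorem WTrace.of_sub_proj {x x' : Var} {A : Beh Acc 0} {s : List Acc}
    (h : WTrace x' (.sub (List.ofFn fun i => (![x] i, .var (![x'] i))) (.proj A {x})) s) :
    WTrace x (.proj A {x}) s := by
  generalize hX : Beh.sub (List.ofFn fun i => (![x] i, .var (![x'] i))) (Beh.proj A {x}) = X at h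
  induction h generalizing A with
  | nil => exact .nil _
  | cons hs _ ih =>
    subst hX
    rcases hs with ⟨h, _⟩ | ⟨_, B, C, h1, h2, h3⟩
    · cases h
    · obtain ⟨B, rfl, k1⟩ := h1.sub_proj_inv
      obtain ⟨C, rfl, -, k2⟩ := h2.sub_proj_inv
      obtain ⟨D, rfl, k3⟩ := h3.sub_proj_inv
      exact .cons (((WStep.of_step (k2 _ rfl)).head k1).tail k3) (ih rfl)

theorem traces_sub {x x' : Var} {θ θ' : List (Var × Val)} {A : Beh Acc 0}
    (h : ExtendsByRenaming ![x] ![x'] (subFun θ) (subFun θ') A.fv) :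
    traces x' (.sub θ' A) ⊆ traces x A := by
  intro s hs
  have := Sim.proj_sub h
  rw [image_singleton, image_singleton] at this
  exact (WTrace.of_sim this hs).of_sub_proj

/-- A weak transition that does not access `x` does not add traces. -/
theorem traces_wstep {x : Var} {A B : Beh Acc 0} {l : Label Acc} (h : WStep A l B)
    (hx : x ∉ l.target) : traces x B ⊆ traces x A := by
  intro s hs
  have : WStep (.proj A {x}) .tau (.proj B {x}) :=
    h.map (F := (Beh.proj · {x})) (fun _ _ h => h.projOut (by simp [Label.target]))
      (fun _ _ h => h.projOut (by simpa using hx)) fun _ => rfl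
  exact WTrace.head this.tauSteps hs

theorem cons_mem_traces {x : Var} {ξ : Acc} {A B : Beh Acc 0} {s : List Acc}
    (h : WStep A (.acc x ξ) B) (hs : s ∈ traces x B) : ξ :: s ∈ traces x A :=
  .cons (h.map (F := (Beh.proj · {x})) (fun _ _ h => h.projOut (by simp [Label.target]))
    (fun _ _ h => h.projIn subset_rfl) id) hs

/-! ## Environments and fresh variables -/

open Filter

/-- Freshness is phrased as holding for all large variables; finitely many such conditions can then
be met by one choice. -/
theorem eventually_notMem {s : Set Var} (hs : s.Finite) : ∀ᶠ x in atTop, x ∉ s :=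
  Nat.cofinite_eq_atTop ▸ hs.eventually_cofinite_notMem

theorem Ctx.eventually_none {Γ : Ctx Acc} (hΓ : {x | Γ x ≠ none}.Finite) :
    ∀ᶠ x in atTop, Γ x = none :=
  (eventually_notMem hΓ).mono fun x hx => by simpa using hx

theorem eventually_fresh (θ : Var → Val) (F : Finset Var) :
    ∀ᶠ x in atTop, ∀ z ∈ F, θ z ≠ .var x := by
  rw [Filter.eventually_all_finset]
  intro z _
  -- If `θ z` is a variable w, its bound is w + 1, so the excluded number is w; for a boolean the
  -- exclusion is harmless.
  filter_upwards [eventually_notMem (Set.finite_singleton ((θ z).bd - 1))] with x hx h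
  simp [h, Val.bd] at hx

section

variable {Γ : Ctx Acc} {n : ℕ} {ys : Fin n → Var} {τ : Fin n → VTy Acc}

theorem Ctx.extend_apply (hy : Function.Injective ys) (i : Fin n) :
    Γ.extend ys τ (ys i) = some (τ i) := hy.extend_apply _ _ i

theorem Ctx.extend_apply' {z : Var} (hz : ∀ i, ys i ≠ z) : Γ.extend ys τ z = Γ z :=
  Function.extend_apply' _ _ _ (by simpa using hz)

theorem Ctx.extend_finite (hΓ : {x | Γ x ≠ none}.Finite) :
    {x | Γ.extend ys τ x ≠ none}.Finite := by
  refine (hΓ.union (Set.finite_range ys)).subset fun x hx => ?_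
  by_cases h : ∃ i, ys i = x
  · exact .inr h
  · rw [Set.mem_ofPred_eq, Ctx.extend_apply' (not_exists.mp h)] at hx
    exact .inl hx

theorem HasVTy.extend {v : Val} {σ : VTy Acc} (h : HasVTy Γ v σ) (hn : ∀ i, Γ (ys i) = none) :
    HasVTy (Γ.extend ys τ) v σ := by
  cases h with
  | bool b => exact .bool b
  | @var x _ hx =>
    refine .var ?_
    rw [Ctx.extend_apply', hx]
    rintro i rfl
    rw [hn i] at hx
    cases hx

theorem HasVTy.extend_subst {Γ' : Ctx Acc} {ys' : Fin n → Var} {θ θ' : Var → Val}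
    {F : Finset Var} (h : ExtendsByRenaming ys ys' θ θ' F) (hn : ∀ i, Γ' (ys' i) = none)
    (hθ : ∀ x σ, Γ x = some σ → HasVTy Γ' (θ x) σ) :
    ∀ x σ, Γ.extend ys τ x = some σ → HasVTy (Γ'.extend ys' τ) (θ' x) σ := by
  intro x σ hx
  by_cases hxy : ∃ i, ys i = x
  · obtain ⟨i, rfl⟩ := hxy
    rw [Ctx.extend_apply h.inj, Option.some.injEq] at hx
    rw [h.on, ← hx]
    exact .var (Ctx.extend_apply h.inj' i)
  · rw [Ctx.extend_apply' (not_exists.mp hxy)] at hx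
    rw [h.off x (not_exists.mp hxy)]
    exact (hθ x σ hx).extend hn

end

theorem HasVTy.subst {Γ Γ' : Ctx Acc} {θ : Var → Val} {v : Val} {σ : VTy Acc}
    (hθ : ∀ x σ, Γ x = some σ → HasVTy Γ' (θ x) σ) (h : HasVTy Γ v σ) :
    HasVTy Γ' (v.subst θ) σ := by
  cases h with
  | bool b => exact .bool b
  | var hx => exact hθ _ _ hx

/-- A well-typed substitution never puts a boolean in subject position; this keeps the labels of
prefixes defined. -/
theorem HasVTy.chan_var {Γ : Ctx Acc} {v : Val} {n : ℕ} {τ : Fin n → VTy Acc} {A : Beh Acc 0} {hA}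
    (h : HasVTy Γ v (.chan n τ A hA)) : ∃ x, v = .var x := by
  cases h; exact ⟨_, rfl⟩

theorem HasVTy.res_var {Γ : Ctx Acc} {v : Val} (h : HasVTy Γ v .res) : ∃ x, v = .var x := by
  cases h; exact ⟨_, rfl⟩

/-- `θ` extended by the renaming of `ys` to `ys'`. -/
def renameSub {n : ℕ} (ys ys' : Fin n → Var) (θ : List (Var × Val)) : List (Var × Val) :=
  (List.ofFn fun i => (ys i, .var (ys' i))) ++ θ

theorem ExtendsByRenaming.renameSub {n : ℕ} {ys ys' : Fin n → Var} {θ : List (Var × Val)}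
    {F : Finset Var} (hy : Function.Injective ys) (hy' : Function.Injective ys')
    (hF : ∀ i, ∀ z ∈ F, subFun θ z ≠ .var (ys' i)) :
    ExtendsByRenaming ys ys' (subFun θ) (subFun (renameSub ys ys' θ)) F where
  inj := hy
  inj' := hy'
  on i := subFun_append_apply hy (fun i => .var (ys' i)) θ i
  off _ hz := subFun_append_apply' _ θ hz
  fresh z hz _ i := hF i z hz

theorem ExtendsByRenaming.mono {n : ℕ} {ys ys' : Fin n → Var} {θ θ' : Var → Val}
    {F G : Finset Var} (h : ExtendsByRenaming ys ys' θ θ' F) (hG : G ⊆ F) :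
    ExtendsByRenaming ys ys' θ θ' G :=
  ⟨h.inj, h.inj', h.on, h.off, fun z hz => h.fresh z (hG hz)⟩

theorem ExtendsByRenaming.close_subst {n : ℕ} {ys ys' : Fin n → Var} {θ θ' : Var → Val}
    {F : Finset Var} (h : ExtendsByRenaming ys ys' θ θ' F) (P : Proc Acc)
    (hP : Finset.range P.bd ⊆ F) :
    (P.rename (closeMap ys)).subst (liftSub n θ) = (P.subst θ').rename (closeMap ys') :=
  P.close_subst h.inj h.inj' h.on h.off fun z hz => h.fresh z (hP (Finset.mem_range.mpr hz))

theorem subFun_inst {n : ℕ} (vs : Fin n → Val) (i : Fin n) :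
    subFun (List.ofFn fun i => ((i : ℕ), vs i)) i = vs i :=
  subFun_ofFn_apply (ys := fun i : Fin n => (i : ℕ)) Fin.val_injective vs i

theorem Sim.sub_inst {n : ℕ} {A : Beh Acc 0} (hA : A.fv ⊆ Finset.range n) (vs : Fin n → Val)
    (θ : List (Var × Val)) :
    Sim (.sub θ (A.inst vs)) (A.inst fun i => (vs i).subst (subFun θ)) := by
  refine Sim.sub_comp A fun z hz => ?_
  obtain ⟨i, rfl⟩ : ∃ i : Fin n, (i : ℕ) = z := ⟨⟨z, Finset.mem_range.mp (hA hz)⟩, rfl⟩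
  rw [subFun_inst vs i, subFun_inst (fun i => (vs i).subst (subFun θ)) i]

/-- The detour through ys is harmless because the ys are distinct, as `Sim.sub_comp'` demands. -/
theorem Sim.inst_sub {n : ℕ} {A : Beh Acc 0} (hA : A.fv ⊆ Finset.range n) {ys : Fin n → Var}
    (hy : Function.Injective ys) (vs : Fin n → Val) :
    Sim (A.inst vs) (.sub (List.ofFn fun i => (ys i, vs i)) (A.inst fun i => .var (ys i))) := by
  have key : ∀ z ∈ A.fv, ∃ i : Fin n, (i : ℕ) = z := fun z hz =>
    ⟨⟨z, Finset.mem_range.mp (hA hz)⟩, rfl⟩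
  refine Sim.sub_comp' A (fun z hz => ?_) fun a ha b hb hab => ?_
  · obtain ⟨i, rfl⟩ := key z hz
    rw [subFun_inst vs i, subFun_inst (fun i => .var (ys i)) i, Val.subst,
      subFun_ofFn_apply hy vs i]
  · obtain ⟨i, rfl⟩ := key a ha
    obtain ⟨j, rfl⟩ := key b hb
    rw [subFun_inst (fun i => .var (ys i)) i, subFun_inst (fun i => .var (ys i)) j,
      Val.var.injEq] at hab
    rw [hy hab]

/-! ## The substitution lemma -/

/-- Each rule is applied again with θ pushed inside, and subsumption moves θ back outside.
Finiteness of `Γ'` supplies fresh names for the bound variables. -/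
theorem Typed.subst {Γ : Ctx Acc} {P : Proc Acc} {A : Beh Acc 0} (h : Typed Γ P A) {Γ' : Ctx Acc}
    (θ : List (Var × Val)) (hΓ' : {x | Γ' x ≠ none}.Finite)
    (hθ : ∀ x σ, Γ x = some σ → HasVTy Γ' (subFun θ x) σ) :
    Typed Γ' (P.subst (subFun θ)) (.sub θ A) := by
  induction h generalizing Γ' θ with
  | zero Γ =>
    refine .sub (.zero _) (Sim.of_step fun l B' h => h.zero_inv.elim)
  | @out Γ x n τ A₁ hA vs P A₂ _ hx hvs ih =>
    have hx' := hx.subst hθ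
    obtain ⟨y, hy⟩ := hx'.chan_var
    rw [Proc.subst, hy]
    rw [hy] at hx'
    refine .sub (.out (ih θ hΓ' hθ) hx' fun i => (hvs i).subst hθ) (.pre ?_ ?_)
    · exact Label.subst_eq_out.mpr ⟨x, rfl, hy⟩
    · exact ((PushSub.base _).par (PushSub.base _)).sim.trans
        ((Sim.sub_inst hA vs θ).par (.refl _))
  | @inp Γ x n τ A₁ hA ys P A₂ hys hn _ hx hs ih =>
    have hx' := hx.subst hθ
    obtain ⟨y, hy⟩ := hx'.chan_var
    rw [Proc.subst, hy]
    rw [hy] at hx'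
    -- All variables from N on are fresh, so N, …, N + n - 1 can name the parameters.
    obtain ⟨N, hN⟩ := eventually_atTop.mp ((Ctx.eventually_none hΓ').and
      (eventually_fresh (subFun θ) (Finset.range P.bd ∪ A₂.fv)))
    have hF := ExtendsByRenaming.renameSub (ys' := fun i => N + i) hys
      (fun i j hij => Fin.ext (Nat.add_left_cancel hij)) fun i => (hN _ (Nat.le_add_right N i)).2
    have hn' : ∀ i : Fin n, Γ' (N + i) = none := fun i => (hN _ (Nat.le_add_right N i)).1
    rw [hF.close_subst P Finset.subset_union_left]
    have hF := hF.mono (G := A₂.fv) Finset.subset_union_right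
    refine .sub (.inp hF.inj' hn' (ih _ (Ctx.extend_finite hΓ')
      (HasVTy.extend_subst hF hn' hθ)) hx' ?_) (.pre ?_ (.excl_sub hF))
    -- The chain is A₁[ys'] ≥ ⟨ys'/ys⟩A₁[ys] ≥ ⟨ys'/ys⟩(A₂↓ys) ≥ (⟨θ'⟩A₂)↓ys'.
    · exact (Sim.inst_sub hA hys _).trans ((hs.sub _).trans (.proj_sub hF))
    · exact Label.subst_eq_inp.mpr ⟨x, rfl, hy⟩
  | par _ _ ihP ihQ =>
    exact .sub (.par (ihP θ hΓ' hθ) (ihQ θ hΓ' hθ)) ((PushSub.base _).par (PushSub.base _)).sim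
  | ite hv _ _ ihP ihQ => exact .ite (hv.subst hθ) (ihP θ hΓ' hθ) (ihQ θ hΓ' hθ)
  | rep _ ih => exact .sub (.rep (ih θ hΓ' hθ)) (PushSub.rep _).sim
  | @new Γ x n τ B hB P A hn _ ih =>
    obtain ⟨x', hn', hx'⟩ := ((Ctx.eventually_none hΓ').and
      (eventually_fresh (subFun θ) (Finset.range P.bd ∪ A.fv))).exists
    have hF := ExtendsByRenaming.renameSub (ys' := ![x']) (singleton_injective x)
      (singleton_injective x') (fun i => by rwa [Matrix.cons_val_fin_one])
    rw [Proc.subst, hF.close_subst P Finset.subset_union_left]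
    have hF := hF.mono (G := A.fv) Finset.subset_union_right
    exact .sub (.new hn' (ih _ (Ctx.extend_finite hΓ')
      (HasVTy.extend_subst hF (fun i => by simpa using hn') hθ))) (.nu_sub hF)
  | @acc Γ x ξ P A _ hx ih =>
    have hx' := hx.subst hθ
    obtain ⟨y, hy⟩ := hx'.res_var
    rw [Proc.subst, hy]
    rw [hy] at hx'
    exact .sub (.acc (ih θ hΓ' hθ) hx') (Sim.acc _ hy)
  | @newR Γ x Φ P A hn _ ht ih =>
    obtain ⟨x', hn', hx'⟩ := ((Ctx.eventually_none hΓ').and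
      (eventually_fresh (subFun θ) (Finset.range P.bd ∪ A.fv))).exists
    have hF := ExtendsByRenaming.renameSub (ys' := ![x']) (singleton_injective x)
      (singleton_injective x') (fun i => by rwa [Matrix.cons_val_fin_one])
    rw [Proc.subst, hF.close_subst P Finset.subset_union_left]
    have hF := hF.mono (G := A.fv) Finset.subset_union_right
    have hs := Sim.excl_sub hF
    rw [image_singleton, image_singleton] at hs
    exact .sub (.newR hn' (ih _ (Ctx.extend_finite hΓ')
      (HasVTy.extend_subst hF (fun i => by simpa using hn') hθ)) ((traces_sub hF).trans ht)) hs
  | sub _ hs ih => exact .sub (ih θ hΓ' hθ) (hs.sub θ)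

/-- This is the empty substitution into the larger environment, removed from the type by
`Sim.sub_nil`. -/
theorem Typed.weaken {Γ : Ctx Acc} {P : Proc Acc} {A : Beh Acc 0} (h : Typed Γ P A)
    (hΓ : {x | Γ x ≠ none}.Finite) {n : ℕ} {ys : Fin n → Var} (hn : ∀ i, Γ (ys i) = none)
    (τ : Fin n → VTy Acc) : Typed (Γ.extend ys τ) P A := by
  have := h.subst (Γ' := Γ.extend ys τ) [] (Ctx.extend_finite hΓ)
    fun x σ hx => (HasVTy.var hx).extend hn
  rw [show subFun [] = Val.var from rfl, Proc.subst_var] at this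
  exact .sub this (.sub_nil A)

/-! ## Inversion of typing -/

/-- In this and the following inversions the uses of subsumption are collapsed into one by
transitivity. -/
theorem Typed.out_inv {Γ : Ctx Acc} {v : Val} {n : ℕ} {vs : Fin n → Val} {P : Proc Acc}
    {A : Beh Acc 0} (h : Typed Γ (.out v vs P) A) :
    ∃ x τ A₁ hA A₂, v = .var x ∧ Typed Γ P A₂ ∧ Γ x = some (.chan n τ A₁ hA) ∧
      (∀ i, HasVTy Γ (vs i) (τ i)) ∧ Sim A (.pre (.out x) (.par (A₁.inst vs) A₂)) := by
  generalize hR : Proc.out v vs P = R at h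
  induction h with
  | out hP hx hvs =>
    cases hR
    cases hx with
    | var hx => exact ⟨_, _, _, _, _, rfl, hP, hx, hvs, .refl _⟩
  | sub _ hs ih =>
    obtain ⟨x, τ, A₁, hA, A₂, h1, h2, h3, h4, h5⟩ := ih hR
    exact ⟨x, τ, A₁, hA, A₂, h1, h2, h3, h4, hs.trans h5⟩
  | _ => cases hR

theorem Typed.inp_inv {Γ : Ctx Acc} {v : Val} {n : ℕ} {Q : Proc Acc}
    {A : Beh Acc 0} (h : Typed Γ (.inp v n Q) A) :
    ∃ x τ A₁ hA A₂ P, ∃ ys : Fin n → Var, v = .var x ∧ Q = P.rename (closeMap ys) ∧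
      Function.Injective ys ∧ (∀ i, Γ (ys i) = none) ∧ Typed (Γ.extend ys τ) P A₂ ∧
      Γ x = some (.chan n τ A₁ hA) ∧
      Sim (A₁.inst fun i => .var (ys i)) (.proj A₂ (Finset.univ.image ys)) ∧
      Sim A (.pre (.inp x) (.excl A₂ (Finset.univ.image ys))) := by
  generalize hR : Proc.inp v n Q = R at h
  induction h with
  | inp hy hn hP hx hs =>
    cases hR
    cases hx with
    | var hx => exact ⟨_, _, _, _, _, _, _, rfl, rfl, hy, hn, hP, hx, hs, .refl _⟩
  | sub _ hs ih =>
    obtain ⟨x, τ, A₁, hA, A₂, P, ys, h1, h2, h3, h4, h5, h6, h7, h8⟩ := ih hR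
    exact ⟨x, τ, A₁, hA, A₂, P, ys, h1, h2, h3, h4, h5, h6, h7, hs.trans h8⟩
  | _ => cases hR

theorem Typed.par_inv {Γ : Ctx Acc} {P Q : Proc Acc} {A : Beh Acc 0}
    (h : Typed Γ (.par P Q) A) :
    ∃ B C, Typed Γ P B ∧ Typed Γ Q C ∧ Sim A (.par B C) := by
  generalize hR : Proc.par P Q = R at h
  induction h with
  | par hP hQ => cases hR; exact ⟨_, _, hP, hQ, .refl _⟩
  | sub _ hs ih =>
    obtain ⟨B, C, h1, h2, h3⟩ := ih hR
    exact ⟨B, C, h1, h2, hs.trans h3⟩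
  | _ => cases hR

theorem Typed.ite_inv {Γ : Ctx Acc} {v : Val} {P Q : Proc Acc} {A : Beh Acc 0}
    (h : Typed Γ (.ite v P Q) A) : Typed Γ P A ∧ Typed Γ Q A := by
  generalize hR : Proc.ite v P Q = R at h
  induction h with
  | ite _ hP hQ => cases hR; exact ⟨hP, hQ⟩
  | sub _ hs ih => exact ⟨(ih hR).1.sub hs, (ih hR).2.sub hs⟩
  | _ => cases hR

theorem Typed.rep_inv {Γ : Ctx Acc} {P : Proc Acc} {A : Beh Acc 0} (h : Typed Γ (.rep P) A) :
    ∃ B, Typed Γ P B ∧ Sim A (.rep B) := by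
  generalize hR : Proc.rep P = R at h
  induction h with
  | rep hP => cases hR; exact ⟨_, hP, .refl _⟩
  | sub _ hs ih =>
    obtain ⟨B, h1, h2⟩ := ih hR
    exact ⟨B, h1, hs.trans h2⟩
  | _ => cases hR

theorem Typed.acc_inv {Γ : Ctx Acc} {ξ : Acc} {v : Val} {P : Proc Acc} {A : Beh Acc 0}
    (h : Typed Γ (.acc ξ v P) A) : ∃ x B, v = .var x ∧ Typed Γ P B ∧ Sim A (.acc x ξ B) := by
  generalize hR : Proc.acc ξ v P = R at h
  induction h with
  | acc hP hx => cases hR; exact ⟨_, _, rfl, hP, .refl _⟩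
  | sub _ hs ih =>
    obtain ⟨x, B, h1, h2, h3⟩ := ih hR
    exact ⟨x, B, h1, h2, hs.trans h3⟩
  | _ => cases hR

/-- A derivation fixes one name for the bound variable; the substitution lemma replaces it by any
large one, at the price of a delayed renaming on the type. -/
theorem Typed.rename_bound {Γ : Ctx Acc} (hΓ : {x | Γ x ≠ none}.Finite) {x : Var} {τ : VTy Acc}
    {P : Proc Acc} {A : Beh Acc 0} (h : Typed (Γ.extend ![x] ![τ]) P A) :
    ∀ᶠ x' in atTop,
      Typed (Γ.extend ![x'] ![τ])
        ((P.rename (closeMap ![x])).subst (instMap fun i => .var (![x'] i)))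
        (.sub (renameSub ![x] ![x'] []) A) ∧
      ExtendsByRenaming ![x] ![x'] (subFun []) (subFun (renameSub ![x] ![x'] [])) A.fv := by
  filter_upwards [Ctx.eventually_none hΓ, eventually_fresh (subFun []) A.fv] with x' hn hx'
  have hF := ExtendsByRenaming.renameSub (ys' := ![x']) (singleton_injective x)
    (singleton_injective x') (fun i => by simpa using hx')
  refine ⟨?_, hF⟩
  rw [Proc.open_close P hF.inj (fun i => .var (![x'] i)) hF.on hF.off]
  exact h.subst _ (Ctx.extend_finite hΓ)
    (HasVTy.extend_subst hF (fun i => by simpa using hn) fun x σ hx => .var hx)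

theorem Typed.nu_inv {Γ : Ctx Acc} (hΓ : {x | Γ x ≠ none}.Finite) {R : Proc Acc} {A : Beh Acc 0}
    (h : Typed Γ (.nu R) A) : ∃ n τ B hB, ∀ᶠ x in atTop, ∃ A',
      Typed (Γ.extend ![x] ![.chan n τ B hB]) (R.subst (instMap fun i => .var (![x] i))) A' ∧
      Sim A (.nu (A'.rename (closeMap ![x]))) := by
  generalize hQ : Proc.nu R = Q at h
  induction h with
  | new hn hP =>
    cases hQ
    refine ⟨_, _, _, _, (hP.rename_bound hΓ).mono fun x' hx' => ⟨_, hx'.1, ?_⟩⟩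
    exact (Sim.sub_nil _).trans (.nu_sub hx'.2)
  | sub _ hs ih =>
    obtain ⟨n, τ, B, hB, h⟩ := ih hΓ hQ
    exact ⟨n, τ, B, hB, h.mono fun x ⟨A', h1, h2⟩ => ⟨A', h1, hs.trans h2⟩⟩
  | _ => cases hQ

theorem Typed.nuR_inv {Γ : Ctx Acc} (hΓ : {x | Γ x ≠ none}.Finite) {Φ : TraceSet Acc}
    {R : Proc Acc} {A : Beh Acc 0} (h : Typed Γ (.nuR Φ R) A) : ∀ᶠ x in atTop, ∃ A',
      Typed (Γ.extend ![x] ![.res]) (R.subst (instMap fun i => .var (![x] i))) A' ∧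
      traces x A' ⊆ Φ.carrier ∧ Sim A (.excl A' {x}) := by
  generalize hQ : Proc.nuR Φ R = Q at h
  induction h with
  | newR hn hP ht =>
    cases hQ
    refine (hP.rename_bound hΓ).mono fun x' hx' => ⟨_, hx'.1, (traces_sub hx'.2).trans ht, ?_⟩
    have := Sim.excl_sub hx'.2
    rw [image_singleton, image_singleton] at this
    exact (Sim.sub_nil _).trans this
  | sub _ hs ih =>
    exact (ih hΓ hQ).mono fun x ⟨A', h1, h2, h3⟩ => ⟨A', h1, h2, hs.trans h3⟩
  | _ => cases hQ

/-- The bound on R keeps x away from its variables, so closing over x restores R. -/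
theorem Typed.nu_intro {Γ : Ctx Acc} {x : Var} {n τ B hB} {R : Proc Acc} {A : Beh Acc 0}
    (hn : Γ x = none) (hR : R.bd ≤ x)
    (h : Typed (Γ.extend ![x] ![.chan n τ B hB]) (R.subst (instMap fun i => .var (![x] i))) A) :
    Typed Γ (.nu R) (.nu (A.rename (closeMap ![x]))) := by
  have := Typed.new hn h
  rwa [R.close_open (singleton_injective x) fun i => by simpa using Nat.le_succ_of_le hR] at this

theorem Typed.nuR_intro {Γ : Ctx Acc} {x : Var} {Φ : TraceSet Acc} {R : Proc Acc} {A : Beh Acc 0}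
    (hn : Γ x = none) (hR : R.bd ≤ x)
    (h : Typed (Γ.extend ![x] ![.res]) (R.subst (instMap fun i => .var (![x] i))) A)
    (ht : traces x A ⊆ Φ.carrier) :
    Typed Γ (.nuR Φ R) (.excl A {x}) := by
  have := Typed.newR hn h ht
  rwa [R.close_open (singleton_injective x) fun i => by simpa using Nat.le_succ_of_le hR] at this

/-! ## The structural preorder -/

/-- The structural preorder preserves typing. -/
theorem SPre.typed {P Q : Proc Acc} (h : SPre P Q) (θ : Var → Val) {Γ : Ctx Acc}
    (hΓ : {x | Γ x ≠ none}.Finite) {A : Beh Acc 0} (hP : Typed Γ (P.subst θ) A) :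
    Typed Γ (Q.subst θ) A := by
  induction h generalizing θ Γ A with
  | refl => exact hP
  | trans _ _ ih ih' => exact ih' θ hΓ (ih θ hΓ hP)
  | zero P =>
    obtain ⟨B, C, h1, h2, h3⟩ := hP.par_inv
    exact h1.sub (h3.trans (.par_left B C))
  | zero' P => exact (hP.par (.zero Γ)).sub (.par_zero A)
  | comm P Q =>
    obtain ⟨B, C, h1, h2, h3⟩ := hP.par_inv
    exact (h2.par h1).sub (h3.trans (.par_comm B C))
  | assoc P Q R =>
    obtain ⟨B, X, h1, h2, h3⟩ := hP.par_inv
    obtain ⟨C, D, h4, h5, h6⟩ := h2.par_inv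
    exact ((h1.par h4).par h5).sub (h3.trans (((Sim.refl B).par h6).trans (.par_assoc B C D)))
  | assoc' P Q R =>
    obtain ⟨X, D, h1, h2, h3⟩ := hP.par_inv
    obtain ⟨B, C, h4, h5, h6⟩ := h1.par_inv
    exact (h4.par (h5.par h2)).sub (h3.trans ((h6.par (.refl D)).trans (.par_assoc' B C D)))
  | rep P =>
    obtain ⟨B, h1, h2⟩ := hP.rep_inv
    exact (h1.rep.par h1).sub (h2.trans (.rep_unfold B))
  | new P Q =>
    obtain ⟨B, C, h1, h2, h3⟩ := hP.par_inv
    obtain ⟨n, τ, D, hD, h4⟩ := h1.nu_inv hΓ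
    obtain ⟨x, ⟨⟨B', h5, h6⟩, hn⟩, hC, hx⟩ := ((h4.and (Ctx.eventually_none hΓ)).and
      ((eventually_notMem C.fv.finite_toSet).and (eventually_ge_atTop
        (Proc.par (P.subst (liftSub 1 θ)) ((Q.subst θ).rename (· + 1))).bd))).exists
    have h7 := h2.weaken hΓ (ys := ![x]) (fun i => by simpa using hn) ![.chan n τ D hD]
    rw [Proc.subst, Proc.subst, Proc.shift_subst]
    refine (Typed.nu_intro (τ := τ) (hB := hD) hn hx (A := .par B' C) ?_).sub
      (h3.trans ((h6.par (.refl C)).trans (.par_nu B' hC)))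
    rw [Proc.subst, Proc.shift_inst]
    exact h5.par h7
  | newR Φ P Q =>
    obtain ⟨B, C, h1, h2, h3⟩ := hP.par_inv
    have h4 := h1.nuR_inv hΓ
    obtain ⟨x, ⟨⟨B', h5, ht, h6⟩, hn⟩, hC, hx⟩ := ((h4.and (Ctx.eventually_none hΓ)).and
      ((eventually_notMem C.fv.finite_toSet).and (eventually_ge_atTop
        (Proc.par (P.subst (liftSub 1 θ)) ((Q.subst θ).rename (· + 1))).bd))).exists
    have h7 := h2.weaken hΓ (ys := ![x]) (fun i => by simpa using hn) ![.res]
    have hC : Disjoint {x} C.fv := Finset.disjoint_singleton_left.mpr hC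
    rw [Proc.subst, Proc.subst, Proc.shift_subst]
    refine (Typed.nuR_intro hn hx (A := .par B' C) ?_ ?_).sub
      (h3.trans ((h6.par (.refl C)).trans (.par_excl B' hC)))
    · rw [Proc.subst, Proc.shift_inst]
      exact h5.par h7
    -- As x is not free in C, the added component contributes no trace on x.
    · exact fun s hs => ht (WTrace.of_sim (.proj_par B' hC) hs)
  | par _ _ ih ih' =>
    obtain ⟨B, C, h1, h2, h3⟩ := hP.par_inv
    exact ((ih θ hΓ h1).par (ih' θ hΓ h2)).sub h3
  | @cnew P Q _ ih =>
    obtain ⟨n, τ, D, hD, h4⟩ := Typed.nu_inv hΓ hP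
    obtain ⟨x, ⟨⟨B', h5, h6⟩, hn⟩, hx⟩ := ((h4.and (Ctx.eventually_none hΓ)).and
      (eventually_ge_atTop (Q.subst (liftSub 1 θ)).bd)).exists
    -- The opened body is again a substitution instance of P, to which the induction hypothesis
    -- applies; this is why θ is arbitrary.
    rw [Proc.subst_subst] at h5
    refine (Typed.nu_intro (τ := τ) (hB := hD) hn hx ?_).sub h6
    rw [Proc.subst_subst]
    exact ih _ (Ctx.extend_finite hΓ) h5
  | @cnewR Φ P Q _ ih =>
    have h4 := Typed.nuR_inv hΓ hP
    obtain ⟨x, ⟨⟨B', h5, ht, h6⟩, hn⟩, hx⟩ := ((h4.and (Ctx.eventually_none hΓ)).and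
      (eventually_ge_atTop (Q.subst (liftSub 1 θ)).bd)).exists
    rw [Proc.subst_subst] at h5
    refine (Typed.nuR_intro hn hx ?_ ht).sub h6
    rw [Proc.subst_subst]
    exact ih _ (Ctx.extend_finite hΓ) h5

/-! ## Subject reduction -/

/-- The type of a process after an input. -/
theorem Typed.input {Γ : Ctx Acc} (hΓ : {x | Γ x ≠ none}.Finite) {n : ℕ} {ys : Fin n → Var}
    {τ : Fin n → VTy Acc} {P : Proc Acc} {A₁ A₂ : Beh Acc 0} (hA : A₁.fv ⊆ Finset.range n)
    (hy : Function.Injective ys) (hP : Typed (Γ.extend ys τ) P A₂)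
    (hs : Sim (A₁.inst fun i => .var (ys i)) (.proj A₂ (Finset.univ.image ys)))
    {vs : Fin n → Val} (hvs : ∀ i, HasVTy Γ (vs i) (τ i)) :
    Typed Γ ((P.rename (closeMap ys)).subst (instMap vs))
      (.par (A₁.inst vs) (.excl A₂ (Finset.univ.image ys))) := by
  rw [Proc.open_close P hy vs (θ := subFun (List.ofFn fun i => (ys i, vs i)))
    (subFun_ofFn_apply hy vs) fun z hz => subFun_ofFn_apply' vs hz]
  -- Here A₁[vs] ≥ ⟨vs/ys⟩A₁[ys] ≥ ⟨vs/ys⟩(A₂↓ys), and with A₂↑ys this simulates ⟨vs/ys⟩A₂.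
  refine (hP.subst _ hΓ fun x σ hx => ?_).sub
    ((((Sim.inst_sub hA hy vs).trans (hs.sub _)).par (.refl _)).trans
      (.proj_par_excl (fun z hz => subFun_ofFn_apply' vs fun i hi => hz ?_) A₂))
  · by_cases hxy : ∃ i, ys i = x
    · obtain ⟨i, rfl⟩ := hxy
      rw [Ctx.extend_apply hy, Option.some.injEq] at hx
      rw [subFun_ofFn_apply hy, ← hx]
      exact hvs i
    · rw [Ctx.extend_apply' (not_exists.mp hxy)] at hx
      rw [subFun_ofFn_apply' vs (not_exists.mp hxy)]
      exact .var hx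
  · simp [← hi]

/-- A renaming with the bound variable `0` renamed to `x`. -/
def consRen (x : Var) (f : Var → Var) : Var → Var
  | 0 => x
  | z + 1 => f z

theorem Proc.open_rename (P : Proc Acc) (x : Var) (f : Var → Var) :
    (P.subst (liftSub 1 fun z => .var (f z))).subst (instMap fun i => .var (![x] i)) =
      P.subst fun z => .var (consRen x f z) := by
  rw [Proc.subst_subst]
  congr 1
  funext z
  cases z <;> simp [liftSub, Val.subst, instMap, consRen, Val.rename]

theorem RLabel.rename_consRen (L : RLabel Acc) (x : Var) (f : Var → Var) :
    (L.rename (· + 1)).rename (consRen x f) = L.rename f := by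
  cases L <;> rfl

theorem WStep.nu {A B : Beh Acc 0} {x : Var} {l : Label Acc} (h : WStep A l B)
    (hx : x ∉ l.target) :
    WStep (.nu (A.rename (closeMap ![x]))) l (.nu (B.rename (closeMap ![x]))) := by
  have hc := closeMap_injective (singleton_injective x)
  refine h.map (F := fun A => .nu (A.rename (closeMap ![x]))) (fun _ _ h => ?_) (fun _ _ h => ?_) id
  · have := h.rename hc
    exact .new (l := .tau) this
  · have := h.rename hc
    rw [Label.rename_close hx] at this
    exact .new this

theorem WStep.excl {A B : Beh Acc 0} {x : Var} {l : Label Acc} (h : WStep A l B)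
    (hx : x ∉ l.target) : WStep (.excl A {x}) l (.excl B {x}) :=
  h.map (F := (Beh.excl · {x})) (fun _ _ h => h.exclOut (by simp [Label.target]))
    (fun _ _ h => h.exclOut (by simpa using hx)) id

/-- The renaming f absorbs the variables with which binders are opened. An arbitrary substitution
would not do here, as it could turn the accessed variable of a label into a boolean. -/
theorem Red.typed {P P' : Proc Acc} {L : RLabel Acc} (h : Red P L P') (f : Var → Var)
    {Γ : Ctx Acc} (hΓ : {x | Γ x ≠ none}.Finite) {A : Beh Acc 0}
    (hP : Typed Γ (P.subst fun z => .var (f z)) A) :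
    ∃ A', WStep A (.ofRLabel (L.rename f)) A' ∧ Typed Γ (P'.subst fun z => .var (f z)) A' := by
  induction h generalizing f Γ A with
  | com x vs P Q =>
    obtain ⟨B, C, hB, hC, hA⟩ := hP.par_inv
    obtain ⟨_, τ, A₁, hA₁, A₂, h1, h2, h3, h4, h5⟩ := hB.out_inv
    obtain ⟨_, τ', A₁', hA₁', A₃, P', ys, k1, k2, k3, k4, k5, k6, k7, k8⟩ := hC.inp_inv
    cases h1
    cases k1
    -- Sender and receiver read the channel type from the same environment, so parameter types and
    -- A₁ agree.
    rw [h3] at k6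
    cases k6
    have hQ := Typed.input hΓ hA₁ k3 k5 k7 h4
    rw [← k2] at hQ
    obtain ⟨A', h6, h7⟩ := (hA.trans (h5.par k8)).step
      (Step.comR (.act (.out (f x)) _) (.act (.inp (f x)) _)).tau
    refine ⟨A', h6, ?_⟩
    rw [Proc.subst, Proc.subst_inst]
    exact (h2.par hQ).sub (h7.trans (((Sim.par_comm _ _).par (.refl _)).trans (.par_assoc' _ _ _)))
  | acc ξ x P =>
    obtain ⟨_, B, h1, h2, h3⟩ := hP.acc_inv
    cases h1
    obtain ⟨A', h4, h5⟩ := h3.step (.acc _ _ _)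
    exact ⟨A', h4, h2.sub h5⟩
  | par Q _ ih =>
    obtain ⟨B, C, hB, hC, hA⟩ := hP.par_inv
    obtain ⟨B', h1, h2⟩ := ih f hΓ hB
    obtain ⟨A', h3, h4⟩ := hA.wstep (h1.map (F := (Beh.par · C)) (fun _ _ h => h.parL _)
      (fun _ _ h => h.parL _) id)
    exact ⟨A', h3, (h2.par hC).sub h4⟩
  | iteT P Q => exact ⟨A, .refl A, hP.ite_inv.1⟩
  | iteF P Q => exact ⟨A, .refl A, hP.ite_inv.2⟩
  | @new P L P' _ ih =>
    obtain ⟨n, τ, D, hD, h4⟩ := Typed.nu_inv hΓ hP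
    -- Besides being fresh for Γ and the body, x avoids the renamed label, so the weak transition
    -- passes through ν.
    obtain ⟨x, ⟨⟨B, h5, h6⟩, hn⟩, hx, hl⟩ := ((h4.and (Ctx.eventually_none hΓ)).and
      ((eventually_ge_atTop (P'.subst (liftSub 1 fun z => .var (f z))).bd).and
        (eventually_notMem (Label.ofRLabel (L.rename f)).target.finite_toSet))).exists
    rw [Proc.open_rename] at h5
    obtain ⟨B', h7, h8⟩ := ih _ (Ctx.extend_finite hΓ) h5
    rw [RLabel.rename_consRen] at h7
    rw [← Proc.open_rename] at h8
    obtain ⟨A', h9, h10⟩ := h6.wstep (h7.nu hl)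
    exact ⟨A', h9, (Typed.nu_intro hn hx h8).sub h10⟩
  | @newR1 Φ P ξ P' _ ih =>
    obtain ⟨x, ⟨⟨B, h5, ht, h6⟩, hn⟩, hx⟩ := (((Typed.nuR_inv hΓ hP).and
      (Ctx.eventually_none hΓ)).and
        (eventually_ge_atTop (P'.subst (liftSub 1 fun z => .var (f z))).bd)).exists
    rw [Proc.open_rename] at h5
    obtain ⟨B', h7, h8⟩ := ih _ (Ctx.extend_finite hΓ) h5
    rw [← Proc.open_rename] at h8
    have h7 : WStep B (.acc x ξ) B' := h7
    -- The access is to x itself, so exclusion of x turns it into τ; the trace condition moves to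
    -- the residual of Φ by `cons_mem_traces`.
    obtain ⟨A', h9, h10⟩ := h6.wstep (h7.map (F := (Beh.excl · {x})) (l' := .tau)
      (fun _ _ h => h.exclOut (by simp [Label.target])) (fun _ _ h => h.exclIn subset_rfl) fun _ => rfl)
    exact ⟨A', h9, (Typed.nuR_intro hn hx h8 fun s hs =>
      show ξ :: s ∈ Φ.carrier from ht (cons_mem_traces h7 hs)).sub h10⟩
  | @newR2 Φ P L P' _ ih =>
    obtain ⟨x, ⟨⟨B, h5, ht, h6⟩, hn⟩, hx, hl⟩ := (((Typed.nuR_inv hΓ hP).and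
      (Ctx.eventually_none hΓ)).and
      ((eventually_ge_atTop (P'.subst (liftSub 1 fun z => .var (f z))).bd).and
        (eventually_notMem (Label.ofRLabel (L.rename f)).target.finite_toSet))).exists
    rw [Proc.open_rename] at h5
    obtain ⟨B', h7, h8⟩ := ih _ (Ctx.extend_finite hΓ) h5
    rw [RLabel.rename_consRen] at h7
    rw [← Proc.open_rename] at h8
    obtain ⟨A', h9, h10⟩ := h6.wstep (h7.excl hl)
    exact ⟨A', h9, (Typed.nuR_intro hn hx h8 ((traces_wstep h7 hl).trans ht)).sub h10⟩
  | sp h1 _ h3 ih =>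
    obtain ⟨A', h4, h5⟩ := ih f hΓ (h1.typed _ hΓ hP)
    exact ⟨A', h4, h3.typed _ hΓ h5⟩

end ResPi

theorem mainTheorem2 {Acc : Type*} (Γ : ResPi.Ctx Acc) (hΓ : {x | Γ x ≠ none}.Finite)
    (P P' : ResPi.Proc Acc) (L : ResPi.RLabel Acc) (A : ResPi.Beh Acc 0)
    (hred : ResPi.Red P L P') (hty : ResPi.Typed Γ P A) :
    ∃ A' : ResPi.Beh Acc 0,
      ResPi.WStep A (ResPi.Label.ofRLabel L) A' ∧ ResPi.Typed Γ P' A' := by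
  have h : ∀ Q : ResPi.Proc Acc, Q.subst (fun z => .var (id z)) = Q := fun Q => Q.subst_var
  have hL : L.rename id = L := by cases L <;> rfl
  have := hred.typed id hΓ (A := A) (by rwa [h])
  rwa [h, hL] at this
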